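/- Let $\mathfrak h$ be a complex Hilbert space with an anti-unitary involution $\Gamma$ (so $\Gamma$ is antilinear, $\Gamma^2=1$ and $\langle\Gamma f,\Gamma g\rangle=\langle g,f\rangle$). Let $P,Q$ be the orthogonal projections onto closed subspaces $\mathfrak p,\mathfrak q\subseteq\mathfrak h$, and write $P^\perp=1-P$, $Q^\perp=1-Q$. Assume that $P$ is a basis projection, $P+\Gamma P\Gamma=1$, that $\Gamma\mathfrak q\subseteq\mathfrak q$, and that $\mathfrak p\cap\mathfrak q=\{0\}=\mathfrak p\cap\mathfrak q^\perp$. Let $\varphi\colon\mathfrak q\to\mathfrak q^\perp$ be the densely defined closed linear operator with graph $\{(Qp,Q^\perp p)\mid p\in\mathfrak p\}$, let $\beta\colon\mathfrak p\to\mathfrak p$ be the densely defined closed antilinear operator with graph $\{(Pq,P\Gamma q)\mid q\in\mathfrak q\}$, and put $\Delta_{\mathfrak p}:=\beta^*\beta$, where the adjoint of $\beta$ is given by $\langle y,\beta x\rangle=\langle x,\beta^*y\rangle$ for $x\in\operatorname{dom}\beta$, $y\in\operatorname{dom}\beta^*$. Then $\Delta_{\mathfrak p}$ has a positive self-adjoint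 square root $\Delta_{\mathfrak p}^{1/2}$, which is injective; write $\Delta_{\mathfrak p}^{-1/2}$ for its inverse. The operator $\varphi$ has a polar decomposition $\varphi=\operatorname{sgn}\varphi\cdot|\varphi|$, where $|\varphi|=(\varphi^*\varphi)^{1/2}$ is the positive self-adjoint square root and $\operatorname{sgn}\varphi\colon\mathfrak q\to\mathfrak q^\perp$ is the partial isometry with $\ker\operatorname{sgn}\varphi=\ker\varphi$. Moreover $\operatorname{dom}\varphi^*\varphi=QP\mathfrak q$, all terms in the following formulas are well defined, and $$|\varphi|(q)=\Delta_{\mathfrak p}^{1/2}(Pq)+\Gamma\,\Delta_{\mathfrak p}^{-1/2}(P\Gamma q),\qquad q\in\operatorname{dom}\varphi^*\varphi,$$ $$\operatorname{sgn}\varphi(q)=\Delta_{\mathfrak p}^{1/2}(Pq)-\Gamma\,\Delta_{\mathfrak p}^{1/2}(P\Gamma q),\qquad q\in\mathfrak q.$$ Finally, $\operatorname{sgn}\varphi$ is an isometry of $\mathfrak q$ onto $\mathfrak q^\perp$; extended by $0$ on $\mathfrak q^\perp$ to an operator on $\mathfrak h$, it satisfies $(\operatorname{sgn}\varphi)^*\operatorname{sgn}\varphi=Q$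 and $\operatorname{sgn}\varphi\,(\operatorname{sgn}\varphi)^*=Q^\perp$. -/

import Mathlib

open scoped InnerProductSpace

noncomputable section

namespace PolarCAR

/-! ### Unbounded operators -/

section Operators

/-- The composition `g ∘ f` of two (semilinear) operators on its natural domain
`{x ∈ dom f | f x ∈ dom g}`. -/
def pcomp {σ τ ρ : ℂ →+* ℂ} [RingHomCompTriple σ τ ρ] {E F G : Type*}
    [AddCommGroup E] [Module ℂ E] [AddCommGroup F] [Module ℂ F] [AddCommGroup G] [Module ℂ G]
    (g : F →ₛₗ.[τ] G) (f : E →ₛₗ.[σ] F) : E →ₛₗ.[ρ] G :=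
  g.comp (f.domRestrict ((g.domain.comap f.toFun).map f.domain.subtype)) (by
    rintro ⟨x, hx, hxf⟩
    obtain ⟨y, hy, rfl⟩ := hx
    have h : f.domRestrict ((g.domain.comap f.toFun).map f.domain.subtype)
        ⟨f.domain.subtype y, ⟨⟨y, hy, rfl⟩, hxf⟩⟩ = f y :=
      LinearPMap.domRestrict_apply rfl
    rw [h]
    exact hy)

/-- The operator with graph `{(A v, B v) | v ∈ V}`. -/
def ofParam {σ : ℂ →+* ℂ} {V E F : Type*}
    [AddCommGroup V] [Module ℂ V] [AddCommGroup E] [Module ℂ E] [AddCommGroup F] [Module ℂ F]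
    (A : V →ₗ[ℂ] E) (B : V →ₛₗ[σ] F) (h : LinearMap.ker A ≤ LinearMap.ker B) : E →ₛₗ.[σ] F where
  domain := LinearMap.range A
  toFun := ((LinearMap.ker A).liftQ B h).comp A.quotKerEquivRange.symm.toLinearMap

theorem ofParam_apply {σ : ℂ →+* ℂ} {V E F : Type*}
    [AddCommGroup V] [Module ℂ V] [AddCommGroup E] [Module ℂ E] [AddCommGroup F] [Module ℂ F]
    (A : V →ₗ[ℂ] E) (B : V →ₛₗ[σ] F) (h : LinearMap.ker A ≤ LinearMap.ker B) (v : V) :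
    ofParam A B h ⟨A v, ⟨v, rfl⟩⟩ = B v := by
  have : A.quotKerEquivRange.symm ⟨A v, ⟨v, rfl⟩⟩ = (LinearMap.ker A).mkQ v := by
    rw [LinearEquiv.symm_apply_eq]
    rfl
  change (LinearMap.ker A).liftQ B h (A.quotKerEquivRange.symm ⟨A v, ⟨v, rfl⟩⟩) = B v
  rw [this]
  simp

variable {E F : Type*} [NormedAddCommGroup E] [InnerProductSpace ℂ E]
  [NormedAddCommGroup F] [InnerProductSpace ℂ F]

open Classical in
/-- The adjoint of a densely defined antilinear operator `f`: `(y, z)` is in the graph of `f*` iff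
`⟪y, f x⟫ = ⟪x, z⟫` for all `x ∈ dom f`. (As for `LinearPMap.adjoint`, the value is `0` if `f` is
not densely defined.) -/
def antiadjoint (f : E →ₛₗ.[starRingEnd ℂ] F) : F →ₛₗ.[starRingEnd ℂ] E where
  domain :=
    { carrier := {y | ∃ z : E, ∀ x : f.domain, ⟪y, f x⟫_ℂ = ⟪(x : E), z⟫_ℂ}
      zero_mem' := ⟨0, fun x => by simp⟩
      add_mem' := by
        rintro y₁ y₂ ⟨z₁, h₁⟩ ⟨z₂, h₂⟩
        exact ⟨z₁ + z₂, fun x => by rw [inner_add_left, inner_add_right, h₁, h₂]⟩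
      smul_mem' := by
        rintro c y ⟨z, h⟩
        exact ⟨starRingEnd ℂ c • z, fun x => by rw [inner_smul_left, inner_smul_right, h]⟩ }
  toFun :=
    if hf : Dense (f.domain : Set E) then
      { toFun := fun y => y.2.choose
        map_add' := fun y₁ y₂ => hf.eq_of_inner_right ℂ fun x hx => by
          rw [inner_add_right, ← (y₁ + y₂).2.choose_spec ⟨x, hx⟩, ← y₁.2.choose_spec ⟨x, hx⟩,
            ← y₂.2.choose_spec ⟨x, hx⟩, ← inner_add_left]
          rfl
        map_smul' := fun c y => hf.eq_of_inner_right ℂ fun x hx => by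
          rw [inner_smul_right, ← (c • y).2.choose_spec ⟨x, hx⟩, ← y.2.choose_spec ⟨x, hx⟩,
            ← inner_smul_left]
          rfl }
    else 0

/-- `S` is the positive self-adjoint square root of `A`: `S = S*`, `S ≥ 0` and `S ∘ S = A`, with
equality of domains. -/
structure IsPosSqrt [CompleteSpace E] (A S : E →ₗ.[ℂ] E) : Prop where
  selfAdjoint : IsSelfAdjoint S
  nonneg : ∀ x : S.domain, 0 ≤ (⟪(x : E), S x⟫_ℂ).re
  comp_self : pcomp S S = A

open Classical in
/-- The positive self-adjoint square root `A^{1/2}` of a positive self-adjoint operator `A`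
(and `0` if there is none). -/
def posSqrt [CompleteSpace E] (A : E →ₗ.[ℂ] E) : E →ₗ.[ℂ] E :=
  if h : ∃ S, IsPosSqrt A S then h.choose else 0

/-- The absolute value `|T| = (T* T)^{1/2}`. -/
def absOp [CompleteSpace E] [CompleteSpace F] (T : E →ₗ.[ℂ] F) : E →ₗ.[ℂ] E :=
  posSqrt (pcomp T.adjoint T)

/-- `T = U A` is the polar decomposition of `T`: the operator `A` is `(T* T)^{1/2}`, and `U` is a
partial isometry with the same kernel as `T`. -/
structure IsPolarDecomposition [CompleteSpace E] [CompleteSpace F]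
    (T : E →ₗ.[ℂ] F) (U : E →L[ℂ] F) (A : E →ₗ.[ℂ] E) : Prop where
  abs : IsPosSqrt (pcomp T.adjoint T) A
  partialIsometry : ∀ x ∈ (LinearMap.ker U.toLinearMap)ᗮ, ‖U x‖ = ‖x‖
  ker_eq : LinearMap.ker U.toLinearMap = (LinearMap.ker T.toFun).map T.domain.subtype
  eq_comp : T = U.toLinearMap.compPMap A

open Classical in
/-- The partial isometry `sgn T` in the polar decomposition `T = sgn T · |T|`
(and `0` if there is none). -/
def sgnOp [CompleteSpace E] [CompleteSpace F] (T : E →ₗ.[ℂ] F) : E →L[ℂ] F :=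
  if h : ∃ U, IsPolarDecomposition T U (absOp T) then h.choose else 0

end Operators

/-! ### A basis projection and an invariant subspace in generic position -/

variable {H : Type*} [NormedAddCommGroup H] [InnerProductSpace ℂ H]

/-- `Γ` is an anti-unitary involution, the orthogonal projection `P` onto `p` is a basis projection,
i.e. `P + Γ P Γ = 1`, the subspace `q` is `Γ`-invariant, and `p ∩ q = {0} = p ∩ q^⊥`. -/
structure IsGenericPair (Γ : H ≃ₗᵢ⋆[ℂ] H) (p q : Submodule ℂ H) [p.HasOrthogonalProjection] :
    Prop where
  involutive : ∀ x, Γ (Γ x) = x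
  basis : ∀ x, p.starProjection x + Γ (p.starProjection (Γ x)) = x
  invariant : ∀ x ∈ q, Γ x ∈ q
  inf_eq_bot : p ⊓ q = ⊥
  inf_orthogonal_eq_bot : p ⊓ qᗮ = ⊥

/-- The orthogonal projection of `H` onto `s`, restricted to a map `r → s`. -/
def projRestrict (r s : Submodule ℂ H) [s.HasOrthogonalProjection] : r →ₗ[ℂ] s :=
  s.orthogonalProjectionOnto.toLinearMap.comp r.subtype

/-- The antilinear map `r → s`, `x ↦ P_s Γ x`. -/
def projConj (Γ : H ≃ₗᵢ⋆[ℂ] H) (r s : Submodule ℂ H) [s.HasOrthogonalProjection] :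
    r →ₗ⋆[ℂ] s :=
  s.orthogonalProjectionOnto.toLinearMap.comp
    (Γ.toLinearEquiv.toLinearMap.comp r.subtype)

variable {Γ : H ≃ₗᵢ⋆[ℂ] H} {p q : Submodule ℂ H}

theorem IsGenericPair.ker_phi [p.HasOrthogonalProjection] [q.HasOrthogonalProjection]
    (h : IsGenericPair Γ p q) :
    LinearMap.ker (projRestrict p q) ≤ LinearMap.ker (projRestrict p qᗮ) := by
  intro x hx
  have h1 : (x : H) ∈ qᗮ := by
    rw [← Submodule.orthogonalProjectionOnto_eq_zero_iff]
    exact hx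
  have h2 : (x : H) ∈ p ⊓ qᗮ := ⟨x.2, h1⟩
  rw [h.inf_orthogonal_eq_bot, Submodule.mem_bot] at h2
  have h3 : x = 0 := Subtype.ext h2
  rw [h3]
  exact Submodule.zero_mem _

theorem IsGenericPair.ker_beta [p.HasOrthogonalProjection] (h : IsGenericPair Γ p q) :
    LinearMap.ker (projRestrict q p) ≤ LinearMap.ker (projConj Γ q p) := by
  intro x hx
  have h1 : (x : H) ∈ pᗮ := by
    rw [← Submodule.orthogonalProjectionOnto_eq_zero_iff]
    exact hx
  have h2 : p.starProjection (Γ x) = Γ x := by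
    have := h.basis (Γ x)
    rwa [h.involutive, (Submodule.starProjection_apply_eq_zero_iff p).2 h1, map_zero,
      add_zero] at this
  have h3 : Γ x ∈ p ⊓ q := ⟨Submodule.starProjection_eq_self_iff.1 h2, h.invariant _ x.2⟩
  rw [h.inf_eq_bot, Submodule.mem_bot] at h3
  have h4 : x = 0 := Subtype.ext (by
    have := h.involutive x
    rw [h3, map_zero] at this
    exact this.symm)
  rw [h4]
  exact Submodule.zero_mem _

/-- The operator `φ : q → q^⊥` with graph `{(Q p, Q^⊥ p) | p ∈ p}`. -/
def phi [p.HasOrthogonalProjection] [q.HasOrthogonalProjection]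
    (h : IsGenericPair Γ p q) : q →ₗ.[ℂ] qᗮ :=
  ofParam (projRestrict p q) (projRestrict p qᗮ) h.ker_phi

/-- The antilinear operator `β : p → p` with graph `{(P q, P Γ q) | q ∈ q}`. -/
def beta [p.HasOrthogonalProjection] (h : IsGenericPair Γ p q) : p →ₛₗ.[starRingEnd ℂ] p :=
  ofParam (projRestrict q p) (projConj Γ q p) h.ker_beta

/-- `Δ_p = β* β`. -/
def modularOp [p.HasOrthogonalProjection] (h : IsGenericPair Γ p q) : p →ₗ.[ℂ] p :=
  pcomp (antiadjoint (beta h)) (beta h)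

/-- `Δ_p^{1/2}`. -/
def modularSqrt [CompleteSpace p] (h : IsGenericPair Γ p q) : p →ₗ.[ℂ] p :=
  posSqrt (modularOp h)

/-- `Δ_p^{-1/2}`, the inverse of `Δ_p^{1/2}`. -/
def modularInvSqrt [CompleteSpace p] (h : IsGenericPair Γ p q) : p →ₗ.[ℂ] p :=
  (modularSqrt h).inverse

/-- The operator `T : q → q^⊥`, regarded as an operator on `H` vanishing on `q^⊥`. -/
def extendByZero (q : Submodule ℂ H) [q.HasOrthogonalProjection] (T : q →L[ℂ] qᗮ) : H →L[ℂ] H :=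
  qᗮ.subtypeL ∘L T ∘L q.orthogonalProjectionOnto

end PolarCAR

end

open scoped InnerProductSpace

noncomputable section

namespace PolarCAR

/-! ### Graphs of operators -/

/-! Since `Γ` exchanges `P` with `1 - P` and commutes with `Q`, the subspaces `p`, `q` are in
generic position: `p` and its complement both meet `q` and `qᗮ` trivially. The operator `Y = 1 - P -
Q + PQ + QP = 1 - (P - Q)²` commutes with `P` and `Q`. Put `c = Y^{1/2}` and `d = (1 - Y)^{1/2}`,
the cosine and sine of the angle between the subspaces. Both are injective, `c² + d² = 1`, and `Γ c
Γ = d`. The operator `Z = PQ + (1 - P)(1 - Q)` satisfies `Z*Z = ZZ* = Y`, so `Z = W c` with `W`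
unitary, commuting with `c` and `d` and carrying `q` onto `p` (`exists_isRotation`).

The graphs of `Δ_p` and `φ*φ` are `{(c²u, d²u)}` with `u` in `p` and in `q` respectively
(`rel_modularOp`, `rel_adjoint_comp_phi`). Hence `Δ_p^{1/2}` and `|φ|` are both `d c⁻¹`, on `p` and
on `q`; `CosSin.rel_iff_of_isPosSqrt` makes this the only positive square root, so it is the one
selected by `posSqrt`. For `v ∈ q` one has `Q W v = c v` and `c W v = P v`: the first gives `φ(c v)
= W v - c v`, the second `Δ_p^{1/2} P v = d W v`. Thus `sgn φ = d W - Γ d W Γ` on `q` is the claimed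
formula, and `signOp_sin` shows that it sends `d v = |φ|(c v)` to `φ(c v)`. -/

/-- `(x, y)` belongs to the graph of `f`. -/
def Rel {σ : ℂ →+* ℂ} {E F : Type*} [AddCommGroup E] [Module ℂ E] [AddCommGroup F] [Module ℂ F]
    (f : E →ₛₗ.[σ] F) (x : E) (y : F) : Prop :=
  ∃ hx : x ∈ f.domain, f ⟨x, hx⟩ = y

section Rel

variable {σ τ ρ : ℂ →+* ℂ} [RingHomCompTriple σ τ ρ] {V E F G : Type*}
  [AddCommGroup V] [Module ℂ V] [AddCommGroup E] [Module ℂ E]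
  [AddCommGroup F] [Module ℂ F] [AddCommGroup G] [Module ℂ G]

theorem rel_apply (f : E →ₛₗ.[σ] F) (x : f.domain) : Rel f x (f x) := ⟨x.2, rfl⟩

theorem Rel.mem {f : E →ₛₗ.[σ] F} {x : E} {y : F} (h : Rel f x y) : x ∈ f.domain := h.1

theorem Rel.unique {f : E →ₛₗ.[σ] F} {x : E} {y z : F} (h : Rel f x y) (h' : Rel f x z) :
    y = z := by
  obtain ⟨_, rfl⟩ := h
  obtain ⟨_, rfl⟩ := h'
  rfl

theorem mem_domain_iff_rel {f : E →ₛₗ.[σ] F} {x : E} : x ∈ f.domain ↔ ∃ y, Rel f x y :=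
  ⟨fun h => ⟨_, h, rfl⟩, fun ⟨_, h⟩ => h.1⟩

theorem ext_rel {f g : E →ₛₗ.[σ] F} (h : ∀ x y, Rel f x y ↔ Rel g x y) : f = g := by
  refine LinearPMap.ext (Submodule.ext fun x => ?_) fun x hf hg => ?_
  · simp only [mem_domain_iff_rel, h]
  · exact ((h _ _).1 ⟨hf, rfl⟩).unique ⟨hg, rfl⟩

theorem rel_pcomp {g : F →ₛₗ.[τ] G} {f : E →ₛₗ.[σ] F} {x : E} {z : G} :
    Rel (pcomp g f) x z ↔ ∃ y, Rel f x y ∧ Rel g y z := by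
  constructor
  · rintro ⟨hx, rfl⟩
    obtain ⟨⟨⟨x, hxf⟩, hfx, rfl⟩, _⟩ := id hx
    exact ⟨f ⟨x, hxf⟩, ⟨hxf, rfl⟩, hfx, rfl⟩
  · rintro ⟨_, ⟨hx, rfl⟩, hy, rfl⟩
    exact ⟨⟨⟨⟨x, hx⟩, hy, rfl⟩, hx⟩, rfl⟩

theorem rel_ofParam {A : V →ₗ[ℂ] E} {B : V →ₛₗ[σ] F} {h : LinearMap.ker A ≤ LinearMap.ker B}
    {x : E} {y : F} : Rel (ofParam A B h) x y ↔ ∃ v, A v = x ∧ B v = y := by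
  constructor
  · rintro ⟨⟨v, rfl⟩, rfl⟩
    exact ⟨v, rfl, (ofParam_apply A B h v).symm⟩
  · rintro ⟨v, rfl, rfl⟩
    exact ⟨⟨v, rfl⟩, ofParam_apply A B h v⟩

theorem rel_inverse {f : E →ₗ.[ℂ] F} (hf : LinearMap.ker f.toFun = ⊥) {x : E} {y : F}
    (h : Rel f x y) : Rel f.inverse y x := by
  obtain ⟨hx, rfl⟩ := h
  obtain ⟨z, hz, hz'⟩ := (LinearPMap.mem_graph_iff _).1 (LinearPMap.mem_inverse_graph hf ⟨x, hx⟩)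
  simp only at hz hz'
  have := rel_apply f.inverse z
  rwa [hz, hz'] at this

end Rel

/-! ### Adjoints described by their graphs. -/

section Adjoint

variable {E F : Type*} [NormedAddCommGroup E] [InnerProductSpace ℂ E]
  [NormedAddCommGroup F] [InnerProductSpace ℂ F]

theorem rel_adjoint [CompleteSpace E] {T : E →ₗ.[ℂ] F} (hT : Dense (T.domain : Set E))
    {y : F} {z : E} : Rel T.adjoint y z ↔ ∀ x w, Rel T x w → ⟪y, w⟫_ℂ = ⟪z, x⟫_ℂ := by
  constructor
  · rintro ⟨hy, rfl⟩ x _ ⟨hx, rfl⟩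
    exact (T.adjoint_isFormalAdjoint hT ⟨y, hy⟩ ⟨x, hx⟩).symm
  · intro h
    have h' : ∀ x : T.domain, ⟪z, (x : E)⟫_ℂ = ⟪y, T x⟫_ℂ := fun x => (h _ _ (rel_apply T x)).symm
    exact ⟨T.mem_adjoint_domain_of_exists y ⟨z, h'⟩, LinearPMap.adjoint_apply_eq hT _ h'⟩

theorem rel_antiadjoint {f : E →ₛₗ.[starRingEnd ℂ] F} (hf : Dense (f.domain : Set E))
    {y : F} {z : E} : Rel (antiadjoint f) y z ↔ ∀ x w, Rel f x w → ⟪y, w⟫_ℂ = ⟪x, z⟫_ℂ := by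
  have key : ∀ hy : y ∈ (antiadjoint f).domain, ∀ x : f.domain,
      ⟪y, f x⟫_ℂ = ⟪(x : E), antiadjoint f ⟨y, hy⟩⟫_ℂ := by
    intro hy x
    have : antiadjoint f ⟨y, hy⟩ = hy.choose := by
      change (antiadjoint f).toFun ⟨y, hy⟩ = _
      simp only [antiadjoint, dif_pos hf]
      rfl
    rw [this]
    exact hy.choose_spec x
  constructor
  · rintro ⟨hy, rfl⟩ x _ ⟨hx, rfl⟩
    exact key hy ⟨x, hx⟩
  · intro h
    have hy : y ∈ (antiadjoint f).domain := ⟨z, fun x => h _ _ (rel_apply f x)⟩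
    refine ⟨hy, hf.eq_of_inner_right ℂ fun x hx => ?_⟩
    rw [← key hy ⟨x, hx⟩, h _ _ (rel_apply f ⟨x, hx⟩)]

theorem rel_selfAdjoint [CompleteSpace E] {T : E →ₗ.[ℂ] E} (hT : IsSelfAdjoint T)
    {y z : E} : Rel T y z ↔ ∀ x w, Rel T x w → ⟪y, w⟫_ℂ = ⟪z, x⟫_ℂ := by
  rw [← rel_adjoint hT.dense_domain, LinearPMap.isSelfAdjoint_def.1 hT]

end Adjoint

/-! ### Operators of the form `D C⁻¹` -/

section CosSin

variable {E : Type*} [NormedAddCommGroup E] [InnerProductSpace ℂ E] [CompleteSpace E]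

/-- `C` and `D` are commuting positive bounded operators with `C² + D² = 1`, and `C` is
injective. -/
structure CosSin (C D : E →L[ℂ] E) : Prop where
  cos_pos : 0 ≤ C
  sin_pos : 0 ≤ D
  comm : ∀ x, C (D x) = D (C x)
  sq_add_sq : ∀ x, C (C x) + D (D x) = x
  cos_inj : ∀ x, C x = 0 → x = 0

omit [CompleteSpace E] in
theorem inner_left_of_nonneg {C : E →L[ℂ] E} (hC : 0 ≤ C) (x y : E) : ⟪C x, y⟫_ℂ = ⟪x, C y⟫_ℂ :=
  ((ContinuousLinearMap.nonneg_iff_isPositive C).1 hC).isSymmetric x y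

theorem denseRange_of_nonneg {C : E →L[ℂ] E} (hC : 0 ≤ C) (h : ∀ x, C x = 0 → x = 0) :
    DenseRange C := by
  have : (LinearMap.range C.toLinearMap)ᗮ = ⊥ := by
    rw [Submodule.eq_bot_iff]
    intro x hx
    refine h x (ext_inner_left ℂ fun v => ?_)
    rw [← inner_left_of_nonneg hC, inner_zero_right]
    exact (Submodule.mem_orthogonal _ _).1 hx _ ⟨v, rfl⟩
  have h2 := (Submodule.dense_iff_topologicalClosure_eq_top).2
    ((Submodule.topologicalClosure_eq_top_iff).2 this)
  exact h2

variable {C D : E →L[ℂ] E}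

-- The vector `v = C x + D y` undoes the rotation. The graph of `D C⁻¹` is thus cut out by one
-- bounded equation, with no inverse in it.
omit [CompleteSpace E] in
theorem CosSin.rel_ofParam_iff (h : CosSin C D) {x y : E} :
    (∃ v, C v = x ∧ D v = y) ↔ D x = C y := by
  constructor
  · rintro ⟨v, rfl, rfl⟩
    exact (h.comm v).symm
  · intro hxy
    refine ⟨C x + D y, ?_, ?_⟩
    · rw [map_add, h.comm, ← hxy, h.sq_add_sq]
    · rw [map_add, ← h.comm, hxy, h.sq_add_sq]

omit [CompleteSpace E] in
theorem CosSin.ker_le (h : CosSin C D) :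
    LinearMap.ker C.toLinearMap ≤ LinearMap.ker D.toLinearMap := fun x hx => by
  rw [h.cos_inj x hx]
  exact zero_mem _

/-- A positive self-adjoint `D C⁻¹` is the positive square root of `D² C⁻²`. -/
theorem CosSin.isPosSqrt (h : CosSin C D) {A : E →ₗ.[ℂ] E}
    (hA : ∀ x y, Rel A x y ↔ ∃ u, C (C u) = x ∧ D (D u) = y) :
    IsPosSqrt A (ofParam C.toLinearMap D.toLinearMap h.ker_le) := by
  set S := ofParam C.toLinearMap D.toLinearMap h.ker_le
  have hS : ∀ x y, Rel S x y ↔ D x = C y := fun x y => by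
    rw [rel_ofParam, ← h.rel_ofParam_iff]; rfl
  have hd : Dense (S.domain : Set E) := by
    have := denseRange_of_nonneg h.cos_pos h.cos_inj
    change Dense ((LinearMap.range C.toLinearMap : Submodule ℂ E) : Set E)
    exact this
  refine ⟨?_, ?_, ?_⟩
  · rw [LinearPMap.isSelfAdjoint_def]
    refine ext_rel fun y z => ?_
    rw [rel_adjoint hd, hS]
    constructor
    · intro H
      refine ext_inner_right ℂ fun v => ?_
      have := H (C v) (D v) ((hS _ _).2 (h.comm v).symm)
      rwa [← inner_left_of_nonneg h.sin_pos, ← inner_left_of_nonneg h.cos_pos] at this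
    · intro hyz x w hxw
      obtain ⟨v, rfl, rfl⟩ := h.rel_ofParam_iff.2 ((hS _ _).1 hxw)
      rw [← inner_left_of_nonneg h.sin_pos, hyz, inner_left_of_nonneg h.cos_pos]
  · rintro ⟨_, v, rfl⟩
    rw [ofParam_apply]
    have hc : 0 ≤ C * D := Commute.mul_nonneg h.cos_pos h.sin_pos
      (ContinuousLinearMap.ext h.comm)
    have := ((ContinuousLinearMap.nonneg_iff_isPositive _).1 hc).re_inner_nonneg_right v
    change 0 ≤ (⟪C v, D v⟫_ℂ).re
    rw [inner_left_of_nonneg h.cos_pos]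
    exact this
  · refine ext_rel fun x z => ?_
    rw [rel_pcomp, hA]
    constructor
    · rintro ⟨y, hxy, hyz⟩
      obtain ⟨v, rfl, rfl⟩ := h.rel_ofParam_iff.2 ((hS _ _).1 hxy)
      obtain ⟨w, hw, rfl⟩ := h.rel_ofParam_iff.2 ((hS _ _).1 hyz)
      -- As `C w = D v`, the vector `u = C v + D w` satisfies `C u = v` and `D u = w`.
      have hv : C (C v + D w) = v := by rw [map_add, h.comm, hw, h.sq_add_sq]
      have hw' : D (C v + D w) = w := by rw [map_add, ← h.comm, ← hw, h.sq_add_sq]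
      exact ⟨C v + D w, by rw [hv], by rw [hw']⟩
    · rintro ⟨u, rfl, rfl⟩
      refine ⟨D (C u), (hS _ _).2 ?_, (hS _ _).2 ?_⟩
      · rw [h.comm (C u)]
      · rw [h.comm (D u), h.comm u]

/-- The positive square root of `D² C⁻²` is unique: it is `D C⁻¹`. -/
theorem CosSin.rel_iff_of_isPosSqrt (h : CosSin C D) {A T : E →ₗ.[ℂ] E}
    (hA : ∀ x y, Rel A x y ↔ ∃ u, C (C u) = x ∧ D (D u) = y) (hT : IsPosSqrt A T) {x y : E} :
    Rel T x y ↔ D x = C y := by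
  have hTs : ∀ {x y z w}, Rel T x y → Rel T z w → ⟪x, w⟫_ℂ = ⟪y, z⟫_ℂ := fun h1 h2 =>
    (rel_selfAdjoint hT.selfAdjoint).1 h1 _ _ h2
  have hsq : ∀ u, ∃ r, Rel T (C (C u)) r ∧ Rel T r (D (D u)) := fun u => by
    rw [← rel_pcomp, hT.comp_self, hA]
    exact ⟨u, rfl, rfl⟩
  have hmem : ∀ u, C (C u) ∈ T.domain := fun u => (hsq u).choose_spec.1.mem
  -- The range of `C²` is the domain of `A = T²`, so `R = T C²` is defined everywhere, and `T R =
  -- D²`.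
  let C₂ : E →ₗ[ℂ] T.domain := (C * C).toLinearMap.codRestrict T.domain hmem
  let R₀ : E →ₗ[ℂ] E := T.toFun.comp C₂
  have hR₁ : ∀ u, Rel T (C (C u)) (R₀ u) := fun u => ⟨hmem u, rfl⟩
  have hR₂ : ∀ u, Rel T (R₀ u) (D (D u)) := fun u => by
    obtain ⟨r, h1, h2⟩ := hsq u
    rwa [(hR₁ u).unique h1]
  -- Inserting `1 = C² + D²` turns symmetry of `R₀` into symmetry of `T`; boundedness then follows
  -- from the Hellinger–Toeplitz theorem.
  have hsym : R₀.IsSymmetric := fun u s => by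
    nth_rw 1 [← h.sq_add_sq s]
    nth_rw 2 [← h.sq_add_sq u]
    rw [inner_add_right, inner_add_left, ← hTs (hR₁ u) (hR₁ s), hTs (hR₂ u) (hR₂ s) |>.symm]
  let R : E →L[ℂ] E := ⟨R₀, hsym.continuous⟩
  have hRs : ∀ u v, ⟪R u, v⟫_ℂ = ⟪u, R v⟫_ℂ := hsym
  -- `⟪u, R u⟫ = ⟪C²u, T C²u⟫ + ⟪T R u, R u⟫`, and both terms have nonnegative real part.
  have hR : 0 ≤ R := by
    rw [ContinuousLinearMap.nonneg_iff_isPositive, ContinuousLinearMap.isPositive_def]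
    refine ⟨hsym, fun u => ?_⟩
    have h1 := hT.nonneg ⟨C (C u), hmem u⟩
    have h2 := hT.nonneg ⟨R₀ u, (hR₂ u).mem⟩
    have h3 : T ⟨R₀ u, (hR₂ u).mem⟩ = D (D u) := (rel_apply T _).unique (hR₂ u)
    have h4 : T ⟨C (C u), hmem u⟩ = R₀ u := rfl
    rw [h3] at h2
    rw [h4, hTs (hR₁ u) (hR₁ u)] at h1
    have h5 := add_nonneg h1 h2
    rwa [← Complex.add_re, ← inner_add_right, h.sq_add_sq] at h5
  have hcomm : ∀ u, C (C (R u)) = R (C (C u)) := fun u => by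
    refine ext_inner_right ℂ fun s => ?_
    rw [inner_left_of_nonneg h.cos_pos, inner_left_of_nonneg h.cos_pos, hRs (C (C u))]
    exact (hTs (hR₁ u) (hR₁ s)).symm
  have hRR : ∀ u, R (R u) = C (C (D (D u))) := fun u => by
    have h1 := hR₁ (R u)
    rw [hcomm] at h1
    exact h1.unique (hR₂ (C (C u))) |>.trans (by simp only [h.comm])
  -- Both sides are positive bounded roots of `C²D²`, so the problem is reduced to uniqueness of
  -- bounded roots.
  have hRCD : ∀ u, R u = C (D u) := by
    have hc : Commute C D := ContinuousLinearMap.ext h.comm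
    have h1 : CFC.sqrt (R * R) = R := CFC.sqrt_mul_self R hR
    have h2 : CFC.sqrt ((C * D) * (C * D)) = C * D :=
      CFC.sqrt_mul_self _ (Commute.mul_nonneg h.cos_pos h.sin_pos hc)
    have h3 : R * R = (C * D) * (C * D) := by
      ext u
      change R (R u) = C (D (C (D u)))
      rw [hRR, h.comm (D u)]
    intro u
    rw [← h1, h3, h2]
    rfl
  have hle : ∀ {x y}, Rel T x y → D x = C y := fun {x y} hxy => by
    rw [← sub_eq_zero]
    refine h.cos_inj _ ?_
    rw [map_sub, sub_eq_zero]
    refine ext_inner_left ℂ fun u => ?_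
    have := hTs (hR₁ u) hxy
    change _ = ⟪R u, x⟫_ℂ at this
    rw [hRs, hRCD] at this
    rw [← this, inner_left_of_nonneg h.cos_pos, inner_left_of_nonneg h.cos_pos]
  -- So far `T ⊆ D C⁻¹`. Since `D C⁻¹` is symmetric and `T` is self-adjoint, the inclusion is an
  -- equality.
  refine ⟨hle, fun hxy => ?_⟩
  rw [rel_selfAdjoint hT.selfAdjoint]
  intro z w hzw
  obtain ⟨v, rfl, rfl⟩ := h.rel_ofParam_iff.2 hxy
  rw [inner_left_of_nonneg h.cos_pos, inner_left_of_nonneg h.sin_pos, hle hzw]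

theorem CosSin.isPosSqrt_posSqrt (h : CosSin C D) {A : E →ₗ.[ℂ] E}
    (hA : ∀ x y, Rel A x y ↔ ∃ u, C (C u) = x ∧ D (D u) = y) : IsPosSqrt A (posSqrt A) := by
  have : ∃ S, IsPosSqrt A S := ⟨_, h.isPosSqrt hA⟩
  rw [posSqrt, dif_pos this]
  exact this.choose_spec

theorem CosSin.rel_posSqrt (h : CosSin C D) {A : E →ₗ.[ℂ] E}
    (hA : ∀ x y, Rel A x y ↔ ∃ u, C (C u) = x ∧ D (D u) = y) {x y : E} :
    Rel (posSqrt A) x y ↔ ∃ v, C v = x ∧ D v = y := by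
  rw [h.rel_ofParam_iff, h.rel_iff_of_isPosSqrt hA (h.isPosSqrt_posSqrt hA)]

end CosSin

/-! ### Two projections in generic position -/

section Rotation

variable {H : Type*} [NormedAddCommGroup H] [InnerProductSpace ℂ H]

/-- `Γ` is only given as norm preserving, so this is polarization; antilinearity flips the sign of
`i`, which exchanges the arguments. -/
theorem inner_conj_conj (Γ : H ≃ₗᵢ⋆[ℂ] H) (x y : H) : ⟪Γ x, Γ y⟫_ℂ = ⟪y, x⟫_ℂ := by
  have h1 : ∀ u v : H, ‖u - Complex.I • v‖ = ‖v + Complex.I • u‖ := fun u v => by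
    have : u - Complex.I • v = (-Complex.I) • (v + Complex.I • u) := by
      rw [smul_add, smul_smul, neg_mul, Complex.I_mul_I, neg_neg, one_smul, neg_smul]
      abel
    rw [this, norm_smul]
    simp
  have h2 : Γ (Complex.I • y) = -(Complex.I • Γ y) := by simp [map_smulₛₗ]
  have h3 : ‖Γ x - Complex.I • Γ y‖ = ‖y - Complex.I • x‖ := by
    rw [h1 y x, ← Γ.norm_map (x + Complex.I • y), map_add, h2, sub_eq_add_neg]
  have h4 : ‖Γ x + Complex.I • Γ y‖ = ‖y + Complex.I • x‖ := by
    rw [← h1 x y, ← Γ.norm_map (x - Complex.I • y), map_sub, h2, sub_neg_eq_add]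
  rw [inner_eq_sum_norm_sq_div_four, inner_eq_sum_norm_sq_div_four]
  have h5 : ‖Γ x + Γ y‖ = ‖y + x‖ := by rw [← map_add, Γ.norm_map, add_comm]
  have h6 : ‖Γ x - Γ y‖ = ‖y - x‖ := by rw [← map_sub, Γ.norm_map, norm_sub_rev]
  change (_ + (_ - _) * _) / _ = (_ + (_ - _) * _) / _
  erw [h3, h4, h5, h6]
  rfl

theorem inner_conj_left {Γ : H ≃ₗᵢ⋆[ℂ] H} (hΓ : ∀ x, Γ (Γ x) = x) (x y : H) :
    ⟪Γ x, y⟫_ℂ = ⟪Γ y, x⟫_ℂ := by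
  rw [← inner_conj_conj Γ y (Γ x), hΓ, ← inner_conj_conj Γ x, hΓ]

/-- The operator `Γ T Γ`. -/
def conjOp (Γ : H ≃ₗᵢ⋆[ℂ] H) (T : H →L[ℂ] H) : H →L[ℂ] H :=
  (Γ.toContinuousLinearEquiv : H →SL[starRingEnd ℂ] H).comp
    (T.comp (Γ.toContinuousLinearEquiv : H →SL[starRingEnd ℂ] H))

theorem conjOp_apply (Γ : H ≃ₗᵢ⋆[ℂ] H) (T : H →L[ℂ] H) (x : H) :
    conjOp Γ T x = Γ (T (Γ x)) := rfl

theorem conjOp_nonneg {Γ : H ≃ₗᵢ⋆[ℂ] H} (hΓ : ∀ x, Γ (Γ x) = x) {T : H →L[ℂ] H} (hT : 0 ≤ T) :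
    0 ≤ conjOp Γ T := by
  rw [ContinuousLinearMap.nonneg_iff_isPositive] at hT ⊢
  rw [ContinuousLinearMap.isPositive_def]
  refine ⟨fun x y => ?_, fun x => ?_⟩
  · change ⟪Γ (T (Γ x)), y⟫_ℂ = ⟪x, Γ (T (Γ y))⟫_ℂ
    have h1 := inner_conj_conj Γ (Γ x) (T (Γ y))
    rw [hΓ] at h1
    rw [inner_conj_left hΓ, h1]
    exact (hT.isSymmetric (Γ y) (Γ x)).symm
  · rw [ContinuousLinearMap.reApplyInnerSelf_apply, conjOp_apply, inner_conj_left hΓ]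
    exact hT.re_inner_nonneg_right (Γ x)

variable {Γ : H ≃ₗᵢ⋆[ℂ] H} {p q : Submodule ℂ H}

theorem IsGenericPair.conj_mem_orthogonal [p.HasOrthogonalProjection] (h : IsGenericPair Γ p q)
    {x : H} (hx : x ∈ qᗮ) : Γ x ∈ qᗮ := by
  rw [Submodule.mem_orthogonal'] at hx ⊢
  intro u hu
  rw [inner_conj_left h.involutive, ← inner_conj_symm, hx _ (h.invariant u hu), map_zero]

theorem IsGenericPair.conj_proj_conj [p.HasOrthogonalProjection] (h : IsGenericPair Γ p q)
    (x : H) : Γ (p.starProjection (Γ x)) = x - p.starProjection x :=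
  eq_sub_of_add_eq' (h.basis x)

theorem IsGenericPair.conj_mem_of_mem_orthogonal [p.HasOrthogonalProjection]
    (h : IsGenericPair Γ p q) {x : H} (hx : x ∈ pᗮ) : Γ x ∈ p := by
  have := h.conj_proj_conj x
  rw [(Submodule.starProjection_apply_eq_zero_iff p).2 hx, sub_zero] at this
  rw [← this, h.involutive]
  exact p.starProjection_apply_mem _

theorem IsGenericPair.eq_zero_of_mem [p.HasOrthogonalProjection]
    (h : IsGenericPair Γ p q) {x : H} (hp : x ∈ p) (hq : x ∈ q) : x = 0 := by
  have : x ∈ p ⊓ q := ⟨hp, hq⟩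
  rwa [h.inf_eq_bot, Submodule.mem_bot] at this

theorem IsGenericPair.eq_zero_of_mem_right_orthogonal [p.HasOrthogonalProjection]
    (h : IsGenericPair Γ p q) {x : H} (hp : x ∈ p) (hq : x ∈ qᗮ) : x = 0 := by
  have : x ∈ p ⊓ qᗮ := ⟨hp, hq⟩
  rwa [h.inf_orthogonal_eq_bot, Submodule.mem_bot] at this

/-- `Γ` carries `pᗮ` into `p` and preserves `q` and `qᗮ`, so the two remaining intersections vanish
as well. -/
theorem IsGenericPair.eq_zero_of_mem_left_orthogonal [p.HasOrthogonalProjection]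
    (h : IsGenericPair Γ p q) {x : H} (hp : x ∈ pᗮ) (hq : x ∈ q) : x = 0 :=
  Γ.map_eq_zero_iff.1 (h.eq_zero_of_mem (h.conj_mem_of_mem_orthogonal hp) (h.invariant x hq))

theorem IsGenericPair.eq_zero_of_mem_orthogonal [p.HasOrthogonalProjection]
    (h : IsGenericPair Γ p q) {x : H} (hp : x ∈ pᗮ) (hq : x ∈ qᗮ) : x = 0 :=
  Γ.map_eq_zero_iff.1 (h.eq_zero_of_mem_right_orthogonal (h.conj_mem_of_mem_orthogonal hp)
    (h.conj_mem_orthogonal hq))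

theorem IsGenericPair.proj_conj [p.HasOrthogonalProjection] [q.HasOrthogonalProjection]
    (h : IsGenericPair Γ p q) (x : H) : q.starProjection (Γ x) = Γ (q.starProjection x) := by
  refine Submodule.eq_starProjection_of_mem_orthogonal
    (h.invariant _ (q.starProjection_apply_mem x)) ?_
  rw [← map_sub]
  exact h.conj_mem_orthogonal (q.sub_starProjection_mem_orthogonal x)

/-- The data provided by two projections in generic position: with
`Y = P Q P + P^⊥ Q^⊥ P^⊥`, the operators are `c = Y^{1/2}`, `d = (1 - Y)^{1/2}` and the unitary
part `W` of `P Q + P^⊥ Q^⊥ = W c`. -/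
structure IsRotation (Γ : H ≃ₗᵢ⋆[ℂ] H) (p q : Submodule ℂ H) [p.HasOrthogonalProjection]
    [q.HasOrthogonalProjection] (c d W : H →L[ℂ] H) : Prop where
  cosSin : CosSin c d
  sin_inj : ∀ x, d x = 0 → x = 0
  cos_left : ∀ x, p.starProjection (c x) = c (p.starProjection x)
  cos_right : ∀ x, q.starProjection (c x) = c (q.starProjection x)
  sin_left : ∀ x, p.starProjection (d x) = d (p.starProjection x)
  sin_right : ∀ x, q.starProjection (d x) = d (q.starProjection x)
  cos_cos_left : ∀ x ∈ p, c (c x) = p.starProjection (q.starProjection x)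
  cos_cos_right : ∀ x ∈ q, c (c x) = q.starProjection (p.starProjection x)
  conj_cos : ∀ x, Γ (c x) = d (Γ x)
  conj_sin : ∀ x, Γ (d x) = c (Γ x)
  norm_map : ∀ x, ‖W x‖ = ‖x‖
  cos_comm : ∀ x, W (c x) = c (W x)
  sin_comm : ∀ x, W (d x) = d (W x)
  map_mem : ∀ x ∈ q, W x ∈ p
  exists_eq : ∀ y ∈ p, ∃ x ∈ q, W x = y
  cos_map : ∀ x ∈ q, c (W x) = p.starProjection x

/-- The common element is `Y`. Its form `Z*Z` will give `0 ≤ Y`, and `1 - Y = (P - Q)²` will give `Y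
≤ 1`. -/
theorem two_projections_identities {R : Type*} [Ring R] {P Q : R} (hP : P * P = P)
    (hQ : Q * Q = Q) :
    (Q * P + (1 - Q) * (1 - P)) * (P * Q + (1 - P) * (1 - Q)) = 1 - P - Q + P * Q + Q * P ∧
    (P * Q + (1 - P) * (1 - Q)) * (Q * P + (1 - Q) * (1 - P)) = 1 - P - Q + P * Q + Q * P ∧
    (P - Q) * (P - Q) = 1 - (1 - P - Q + P * Q + Q * P) ∧
    Commute P (1 - P - Q + P * Q + Q * P) ∧ Commute Q (1 - P - Q + P * Q + Q * P) := by
  have hP' : ∀ x, P * (P * x) = P * x := fun x => by rw [← mul_assoc, hP]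
  have hQ' : ∀ x, Q * (Q * x) = Q * x := fun x => by rw [← mul_assoc, hQ]
  refine ⟨?_, ?_, ?_, ?_, ?_⟩ <;>
  simp only [Commute, SemiconjBy, mul_add, add_mul, mul_sub, sub_mul, mul_one, one_mul, mul_assoc,
    hP, hQ, hP', hQ'] <;> abel

/-- `‖Z x‖ = ‖c x‖`, so `c x ↦ Z x` extends from the dense range of `c` to an isometry. Normality of
`Z` makes it commute with `c`; injectivity of `Z*` makes its closed range dense. -/
theorem exists_unitary_part [CompleteSpace H] {c Z : H →L[ℂ] H} (hc : 0 ≤ c)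
    (hinj : ∀ x, c x = 0 → x = 0) (hZ : star Z * Z = c * c) (hZ' : Z * star Z = c * c)
    (hinj' : ∀ x, star Z x = 0 → x = 0) :
    ∃ W : H →L[ℂ] H, (∀ x, W (c x) = Z x) ∧ (∀ x, ‖W x‖ = ‖x‖) ∧ (∀ x, W (c x) = c (W x)) ∧
      Function.Surjective W := by
  have hd := denseRange_of_nonneg hc hinj
  have hn : ∀ x, ‖Z x‖ = ‖c x‖ := fun x => by
    have h1 : ⟪Z x, Z x⟫_ℂ = ⟪c x, c x⟫_ℂ := by
      rw [← ContinuousLinearMap.adjoint_inner_right, inner_left_of_nonneg hc]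
      exact congrArg (fun T : H →L[ℂ] H => ⟪x, T x⟫_ℂ) hZ
    rw [@norm_eq_sqrt_re_inner ℂ, @norm_eq_sqrt_re_inner ℂ, h1]
  -- `Z` commutes with `c² = Z*Z = ZZ*`, hence with the root `c`.
  have hcZ : Commute Z c := by
    have h1 : Commute (c * c) Z := by
      change c * c * Z = Z * (c * c)
      nth_rw 1 [← hZ']
      rw [← hZ, mul_assoc]
    have h2 := Commute.cfcₙ_nnreal h1 NNReal.sqrt
    have h3 : CFC.sqrt (c * c) = c := CFC.sqrt_mul_self c hc
    rw [← h3]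
    exact h2.symm
  have hex : ∃ C : ℝ, ∀ x, ‖Z.toLinearMap x‖ ≤ C * ‖c.toLinearMap x‖ :=
    ⟨1, fun x => by simpa using (hn x).le⟩
  have hW : ∀ x, (Z.toLinearMap.extendOfNorm c.toLinearMap) (c x) = Z x := fun x =>
    LinearMap.extendOfNorm_eq (f := Z.toLinearMap) (e := c.toLinearMap) hd hex x
  set W : H →L[ℂ] H := Z.toLinearMap.extendOfNorm c.toLinearMap
  have hWn : ∀ x, ‖W x‖ = ‖x‖ := fun x => by
    refine hd.induction_on (p := fun x => ‖W x‖ = ‖x‖) x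
      (isClosed_eq (by fun_prop) (by fun_prop)) fun y => ?_
    rw [hW, hn]
  refine ⟨W, hW, hWn, fun x => ?_, ?_⟩
  · refine hd.induction_on (p := fun x => W (c x) = c (W x)) x
      (isClosed_eq (by fun_prop) (by fun_prop)) fun y => ?_
    rw [hW, hW]
    exact congrArg (fun T : H →L[ℂ] H => T y) hcZ
  · have hiso : Isometry W := AddMonoidHomClass.isometry_of_norm W hWn
    have hclosed : IsClosed (Set.range W) := hiso.isClosedEmbedding.isClosed_range
    have hdense : Dense (Set.range W) := by
      have : (LinearMap.range W.toLinearMap)ᗮ = ⊥ := by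
        rw [Submodule.eq_bot_iff]
        intro y hy
        refine hinj' y (ext_inner_left ℂ fun v => ?_)
        rw [inner_zero_right, ContinuousLinearMap.star_eq_adjoint,
          ContinuousLinearMap.adjoint_inner_right, ← hW]
        exact (Submodule.mem_orthogonal _ _).1 hy _ ⟨_, rfl⟩
      exact (Submodule.dense_iff_topologicalClosure_eq_top).2
        ((Submodule.topologicalClosure_eq_top_iff).2 this)
    exact Set.range_eq_univ.1 (hclosed.closure_eq ▸ hdense.closure_eq)

theorem IsGenericPair.exists_isRotation [CompleteSpace H] [p.HasOrthogonalProjection]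
    [q.HasOrthogonalProjection] (h : IsGenericPair Γ p q) :
    ∃ c d W : H →L[ℂ] H, IsRotation Γ p q c d W := by
  set P : H →L[ℂ] H := p.starProjection
  set Q : H →L[ℂ] H := q.starProjection
  have hP : P * P = P := p.isIdempotentElem_starProjection
  have hQ : Q * Q = Q := q.isIdempotentElem_starProjection
  have hPP : ∀ x, P (P x) = P x := fun x => congrArg (fun T : H →L[ℂ] H => T x) hP
  have hQQ : ∀ x, Q (Q x) = Q x := fun x => congrArg (fun T : H →L[ℂ] H => T x) hQ
  have hPs : star P = P := isSelfAdjoint_starProjection p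
  have hQs : star Q = Q := isSelfAdjoint_starProjection q
  obtain ⟨hZ, hZ', hX, hPY, hQY⟩ := two_projections_identities hP hQ
  set Z : H →L[ℂ] H := P * Q + (1 - P) * (1 - Q) with hZdef
  have hZs : star Z = Q * P + (1 - Q) * (1 - P) := by
    simp only [hZdef, star_add, star_mul, star_sub, star_one, hPs, hQs]
  rw [← hZs] at hZ hZ'
  set Y : H →L[ℂ] H := 1 - P - Q + P * Q + Q * P
  have hY : ∀ x, Y x = x - P x - Q x + P (Q x) + Q (P x) := fun x => rfl
  have hY₀ : 0 ≤ Y := hZ ▸ star_mul_self_nonneg Z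
  have hX₀ : 0 ≤ 1 - Y := by
    have : star (P - Q) * (P - Q) = 1 - Y := by rw [star_sub, hPs, hQs, hX]
    exact this ▸ star_mul_self_nonneg (P - Q)
  set c := CFC.sqrt Y
  set d := CFC.sqrt (1 - Y)
  have hcc : c * c = Y := CFC.sqrt_mul_sqrt_self Y hY₀
  have hdd : d * d = 1 - Y := CFC.sqrt_mul_sqrt_self (1 - Y) hX₀
  have hc₀ : 0 ≤ c := CFC.sqrt_nonneg Y
  have hd₀ : 0 ≤ d := CFC.sqrt_nonneg (1 - Y)
  have hccx : ∀ x, c (c x) = Y x := fun x => congrArg (fun T : H →L[ℂ] H => T x) hcc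
  have hddx : ∀ x, d (d x) = x - Y x := fun x => congrArg (fun T : H →L[ℂ] H => T x) hdd
  have comm_c : ∀ {T : H →L[ℂ] H}, Commute T Y → ∀ x, T (c x) = c (T x) := fun {T} hT x =>
    congrArg (fun T : H →L[ℂ] H => T x) (Commute.cfcₙ_nnreal hT.symm NNReal.sqrt).symm
  have comm_d : ∀ {T : H →L[ℂ] H}, Commute T Y → ∀ x, T (d x) = d (T x) := fun {T} hT x =>
    congrArg (fun T : H →L[ℂ] H => T x) (Commute.cfcₙ_nnreal
      ((Commute.one_left T).sub_left hT.symm) NNReal.sqrt).symm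
  have hcY : Commute c Y := by rw [← hcc]; exact (Commute.refl c).mul_right (Commute.refl c)
  -- Replacing `P` by `1 - P` in `Y` gives `1 - Y`, so `Γ c Γ` is a positive root of `1 - Y`.
  have conj_cos : ∀ x, Γ (c x) = d (Γ x) := by
    have h1 : conjOp Γ c * conjOp Γ c = 1 - Y := by
      ext x
      change Γ (c (Γ (Γ (c (Γ x))))) = x - Y x
      rw [h.involutive, hccx, hY, hY]
      have e2 : ∀ y, Q (Γ y) = Γ (Q y) := h.proj_conj
      have e3 : ∀ y, P (Γ y) = Γ (y - P y) := fun y => by rw [← h.conj_proj_conj, h.involutive]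
      rw [e2, e3, e2, e3, ← map_sub, ← map_sub, ← map_add, ← map_add, h.involutive, map_sub]
      abel
    have h2 : conjOp Γ c = d := (CFC.sqrt_unique h1 (conjOp_nonneg h.involutive hc₀)).symm
    intro x
    rw [← h2, conjOp_apply, h.involutive]
  -- The two summands of `Z x` lie in `p` and `pᗮ`, so each vanishes and generic position applies.
  have hinj : ∀ x, Z x = 0 → x = 0 := fun x hx => by
    have hx : P (Q x) + (x - Q x - P (x - Q x)) = 0 := hx
    have h1 : P (Q x) = 0 := by
      have := congrArg P hx
      simpa [map_sub, map_add, hPP] using this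
    have h2 : Q x = 0 := h.eq_zero_of_mem_left_orthogonal
      ((Submodule.starProjection_apply_eq_zero_iff p).1 h1) (q.starProjection_apply_mem x)
    rw [h2, map_zero, zero_add, sub_zero, sub_eq_zero] at hx
    exact h.eq_zero_of_mem_right_orthogonal (Submodule.starProjection_eq_self_iff.1 hx.symm)
      ((Submodule.starProjection_apply_eq_zero_iff q).1 h2)
  have hinj' : ∀ x, star Z x = 0 → x = 0 := fun x hx => by
    rw [hZs] at hx
    have hx : Q (P x) + (x - P x - Q (x - P x)) = 0 := hx
    have h1 : Q (P x) = 0 := by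
      have := congrArg Q hx
      simpa [map_sub, map_add, hQQ] using this
    have h2 : P x = 0 := h.eq_zero_of_mem_right_orthogonal (p.starProjection_apply_mem x)
      ((Submodule.starProjection_apply_eq_zero_iff q).1 h1)
    rw [h2, map_zero, zero_add, sub_zero, sub_eq_zero] at hx
    exact h.eq_zero_of_mem_left_orthogonal
      ((Submodule.starProjection_apply_eq_zero_iff p).1 h2)
      (Submodule.starProjection_eq_self_iff.1 hx.symm)
  have hc_inj : ∀ x, c x = 0 → x = 0 := fun x hx => by
    refine hinj x ?_
    have h1 : ⟪Z x, Z x⟫_ℂ = 0 := by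
      rw [← ContinuousLinearMap.adjoint_inner_right]
      have : star Z (Z x) = Y x := congrArg (fun T : H →L[ℂ] H => T x) hZ
      rw [← ContinuousLinearMap.star_eq_adjoint, this, ← hccx, hx, map_zero, inner_zero_right]
    exact inner_self_eq_zero.1 h1
  obtain ⟨W, hWc, hWn, hWcomm, hWs⟩ := exists_unitary_part hc₀ hc_inj (hZ.trans hcc.symm)
    (hZ'.trans hcc.symm) hinj'
  have hd := denseRange_of_nonneg hc₀ hc_inj
  have hcP := comm_c hPY
  have hcQ := comm_c hQY
  -- `Z Q = P Z = P Q`; this passes to `W` on the dense range of `c`.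
  have hWQ : ∀ x, W (Q x) = P (W x) := fun x => by
    refine hd.induction_on (p := fun x => W (Q x) = P (W x)) x
      (isClosed_eq (by fun_prop) (by fun_prop)) fun y => ?_
    rw [hcQ, hWc, hWc]
    change P (Q (Q y)) + (Q y - Q (Q y) - P (Q y - Q (Q y))) =
      P (P (Q y) + (y - Q y - P (y - Q y)))
    simp [hPP, hQQ, map_sub, map_add]
  refine ⟨c, d, W, ⟨hc₀, hd₀, comm_d hcY, fun x => ?_, hc_inj⟩, fun x hx => ?_, hcP, hcQ,
    comm_d hPY, comm_d hQY, fun x hx => ?_, fun x hx => ?_, conj_cos, fun x => ?_, hWn, hWcomm,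
    ?_, fun x hx => ?_, fun y hy => ?_, fun x hx => ?_⟩
  · rw [hccx, hddx]
    abel
  · refine Γ.map_eq_zero_iff.1 (hc_inj _ (Γ.map_eq_zero_iff.1 ?_))
    rw [conj_cos, h.involutive, hx]
  · rw [hccx, hY, Submodule.starProjection_eq_self_iff.2 hx]
    abel
  · rw [hccx, hY, Submodule.starProjection_eq_self_iff.2 hx]
    abel
  · rw [← h.involutive (c (Γ x)), conj_cos, h.involutive]
  · refine comm_d ?_
    rw [← hcc]
    have : Commute W c := ContinuousLinearMap.ext hWcomm
    exact this.mul_right this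
  · rw [← Submodule.starProjection_eq_self_iff.2 hx, hWQ]
    exact p.starProjection_apply_mem _
  · obtain ⟨x, rfl⟩ := hWs y
    refine ⟨Q x, q.starProjection_apply_mem x, ?_⟩
    rw [hWQ]
    exact Submodule.starProjection_eq_self_iff.2 hy
  · rw [← hWcomm, hWc]
    change P (Q x) + (x - Q x - P (x - Q x)) = P x
    have : Q x = x := Submodule.starProjection_eq_self_iff.2 hx
    simp [this]

end Rotation

/-! ### The operators `Δ_p` and `φ* φ` -/

section Main

variable {H : Type*} [NormedAddCommGroup H] [InnerProductSpace ℂ H]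

/-- The compression of `T` to the subspace `s`. -/
def compress (s : Submodule ℂ H) [s.HasOrthogonalProjection] (T : H →L[ℂ] H) : s →L[ℂ] s :=
  s.orthogonalProjectionOnto ∘L T ∘L s.subtypeL

theorem coe_compress {s : Submodule ℂ H} [s.HasOrthogonalProjection] {T : H →L[ℂ] H}
    (hT : ∀ x, s.starProjection (T x) = T (s.starProjection x)) (x : s) :
    (compress s T x : H) = T x := by
  change s.starProjection (T x) = T x
  rw [hT, Submodule.starProjection_eq_self_iff.2 x.2]

theorem compress_nonneg {s : Submodule ℂ H} [s.HasOrthogonalProjection] {T : H →L[ℂ] H}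
    (hT : ∀ x, s.starProjection (T x) = T (s.starProjection x)) (h₀ : 0 ≤ T) :
    0 ≤ compress s T := by
  rw [ContinuousLinearMap.nonneg_iff_isPositive] at h₀ ⊢
  rw [ContinuousLinearMap.isPositive_def]
  refine ⟨fun x y => ?_, fun x => ?_⟩
  · change ⟪(compress s T x : H), (y : H)⟫_ℂ = ⟪(x : H), (compress s T y : H)⟫_ℂ
    rw [coe_compress hT, coe_compress hT]
    exact h₀.isSymmetric x y
  · rw [ContinuousLinearMap.reApplyInnerSelf_apply, Submodule.coe_inner, coe_compress hT]
    exact h₀.re_inner_nonneg_left x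

theorem CosSin.compress {s : Submodule ℂ H} [s.HasOrthogonalProjection] {c d : H →L[ℂ] H}
    (h : CosSin c d) (hc : ∀ x, s.starProjection (c x) = c (s.starProjection x))
    (hd : ∀ x, s.starProjection (d x) = d (s.starProjection x)) :
    CosSin (compress s c) (compress s d) where
  cos_pos := compress_nonneg hc h.cos_pos
  sin_pos := compress_nonneg hd h.sin_pos
  comm x := Subtype.ext (by
    rw [coe_compress hc, coe_compress hd, coe_compress hd, coe_compress hc, h.comm])
  sq_add_sq x := Subtype.ext (by
    rw [Submodule.coe_add, coe_compress hc, coe_compress hd, coe_compress hd, coe_compress hc,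
      h.sq_add_sq])
  cos_inj x hx := Subtype.ext (h.cos_inj _ (by rw [← coe_compress hc, hx]; rfl))

variable {Γ : H ≃ₗᵢ⋆[ℂ] H} {p q : Submodule ℂ H}

theorem dense_range_projRestrict {r s : Submodule ℂ H} [CompleteSpace s]
    (h : ∀ x ∈ s, x ∈ rᗮ → x = 0) :
    Dense ((LinearMap.range (projRestrict r s) : Submodule ℂ s) : Set s) := by
  have : (LinearMap.range (projRestrict r s))ᗮ = ⊥ := by
    rw [Submodule.eq_bot_iff]
    intro y hy
    refine Subtype.ext (h y y.2 ((Submodule.mem_orthogonal _ _).2 fun u hu => ?_))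
    have := (Submodule.mem_orthogonal _ _).1 hy _ ⟨⟨u, hu⟩, rfl⟩
    rw [← this]
    exact (Submodule.inner_orthogonalProjectionOnto_eq_of_mem_right y u).symm
  exact (Submodule.dense_iff_topologicalClosure_eq_top).2
    ((Submodule.topologicalClosure_eq_top_iff).2 this)

theorem rel_beta [p.HasOrthogonalProjection] (h : IsGenericPair Γ p q) {x y : p} :
    Rel (beta h) x y ↔
      ∃ v ∈ q, p.starProjection v = x ∧ p.starProjection (Γ v) = y := by
  rw [beta, rel_ofParam]
  constructor
  · rintro ⟨v, rfl, rfl⟩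
    exact ⟨v, v.2, rfl, rfl⟩
  · rintro ⟨v, hv, h1, h2⟩
    exact ⟨⟨v, hv⟩, Subtype.ext h1, Subtype.ext h2⟩

theorem rel_phi [p.HasOrthogonalProjection] [q.HasOrthogonalProjection]
    (h : IsGenericPair Γ p q) {x : q} {y : qᗮ} :
    Rel (phi h) x y ↔ ∃ v ∈ p, q.starProjection v = x ∧ v - q.starProjection v = y := by
  have hq : ∀ v, ((qᗮ.orthogonalProjectionOnto v : qᗮ) : H) = v - q.starProjection v := fun v =>
    q.starProjection_orthogonal_val v
  rw [phi, rel_ofParam]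
  constructor
  · rintro ⟨v, rfl, rfl⟩
    exact ⟨v, v.2, rfl, (hq _).symm⟩
  · rintro ⟨v, hv, h1, h2⟩
    exact ⟨⟨v, hv⟩, Subtype.ext h1, Subtype.ext ((hq _).trans h2)⟩

variable [CompleteSpace p] [CompleteSpace q]

-- For `v ∈ q`, `⟪y, P Γ v⟫ = ⟪v, Γ y⟫` and `⟪P v, z⟫ = ⟪v, z⟫`, so the defining condition is
-- orthogonality to `q`.
omit [CompleteSpace q] in
theorem rel_antiadjoint_beta (h : IsGenericPair Γ p q) {y z : p} :
    Rel (antiadjoint (beta h)) y z ↔ (z : H) - Γ y ∈ qᗮ := by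
  have hd : Dense ((beta h).domain : Set p) :=
    dense_range_projRestrict fun x hx hx' => h.eq_zero_of_mem_right_orthogonal hx hx'
  rw [rel_antiadjoint hd, Submodule.mem_orthogonal]
  have key : ∀ v : H, ⟪(y : H), p.starProjection (Γ v)⟫_ℂ = ⟪v, Γ y⟫_ℂ := fun v => by
    rw [← Submodule.inner_starProjection_left_eq_right,
      Submodule.starProjection_eq_self_iff.2 y.2, ← inner_conj_conj Γ, h.involutive]
  have key' : ∀ v : H, ⟪p.starProjection v, (z : H)⟫_ℂ = ⟪v, (z : H)⟫_ℂ := fun v => by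
    rw [Submodule.inner_starProjection_left_eq_right,
      Submodule.starProjection_eq_self_iff.2 z.2]
  constructor
  · intro hyz v hv
    have := hyz _ _ ((rel_beta h).2 ⟨v, hv, rfl, rfl⟩ :
      Rel (beta h) (p.orthogonalProjectionOnto v) (p.orthogonalProjectionOnto (Γ v)))
    rw [Submodule.coe_inner, Submodule.coe_inner] at this
    change ⟪(y : H), p.starProjection (Γ v)⟫_ℂ = ⟪p.starProjection v, (z : H)⟫_ℂ at this
    rw [inner_sub_right, ← key, ← key', this, sub_self]
  · intro hyz x w hxw
    obtain ⟨v, hv, h1, h2⟩ := (rel_beta h).1 hxw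
    have := hyz v hv
    rw [inner_sub_right, sub_eq_zero, ← key, ← key', h1, h2] at this
    exact this.symm

omit [CompleteSpace p] in
theorem rel_adjoint_phi [p.HasOrthogonalProjection] (h : IsGenericPair Γ p q) {y : qᗮ} {z : q} :
    Rel (phi h).adjoint y z ↔ (y : H) - z ∈ pᗮ := by
  have hd : Dense ((phi h).domain : Set q) :=
    dense_range_projRestrict fun x hx hx' => h.eq_zero_of_mem_left_orthogonal hx' hx
  rw [rel_adjoint hd, Submodule.mem_orthogonal']
  have key : ∀ v : H, ⟪(y : H), v - q.starProjection v⟫_ℂ = ⟪(y : H), v⟫_ℂ := fun v => by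
    rw [inner_sub_right, Submodule.inner_left_of_mem_orthogonal (q.starProjection_apply_mem v) y.2,
      sub_zero]
  have key' : ∀ v : H, ⟪(z : H), q.starProjection v⟫_ℂ = ⟪(z : H), v⟫_ℂ := fun v => by
    rw [← Submodule.inner_starProjection_left_eq_right,
      Submodule.starProjection_eq_self_iff.2 z.2]
  constructor
  · intro hyz v hv
    have := hyz (q.orthogonalProjectionOnto v) (qᗮ.orthogonalProjectionOnto v)
      ((rel_phi h).2 ⟨v, hv, rfl, (q.starProjection_orthogonal_val v).symm⟩)
    rw [Submodule.coe_inner, Submodule.coe_inner] at this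
    change ⟪(y : H), qᗮ.starProjection v⟫_ℂ = ⟪(z : H), q.starProjection v⟫_ℂ at this
    rw [q.starProjection_orthogonal_val v, key, key'] at this
    rw [inner_sub_left, this, sub_self]
  · intro hyz x w hxw
    obtain ⟨v, hv, h1, h2⟩ := (rel_phi h).1 hxw
    have := hyz v hv
    rwa [inner_sub_left, sub_eq_zero, ← key, ← key', h2, h1] at this

/-- The parameter is `u = x + z`: if `x = P v` and `y = P Γ v`, then `Γ y = v - x`, and the adjoint
condition says `v = Q (x + z)`. -/
theorem rel_modularOp (h : IsGenericPair Γ p q) {x z : p} :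
    Rel (modularOp h) x z ↔ ∃ u ∈ p, p.starProjection (q.starProjection u) = x ∧
      u - p.starProjection (q.starProjection u) = z := by
  rw [modularOp, rel_pcomp]
  constructor
  · rintro ⟨y, hxy, hyz⟩
    rw [rel_antiadjoint_beta] at hyz
    obtain ⟨v, hv, h1, h2⟩ := (rel_beta h).1 hxy
    rw [← h2, h.conj_proj_conj, h1] at hyz
    have h3 : q.starProjection ((z : H) + x) = v := by
      refine (Submodule.eq_starProjection_of_mem_orthogonal hv ?_).symm ▸ rfl
      convert hyz using 1
      abel
    refine ⟨z + x, add_mem z.2 x.2, ?_, ?_⟩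
    · rw [h3, h1]
    · rw [h3, h1, add_sub_cancel_right]
  · rintro ⟨u, hu, h1, h2⟩
    refine ⟨p.orthogonalProjectionOnto (Γ (q.starProjection u)),
      (rel_beta h).2 ⟨_, q.starProjection_apply_mem u, h1, rfl⟩, (rel_antiadjoint_beta h).2 ?_⟩
    change _ - Γ (p.starProjection (Γ (q.starProjection u))) ∈ _
    rw [h.conj_proj_conj, ← h2]
    convert q.sub_starProjection_mem_orthogonal u using 1
    abel

/-- Again `u = x + z`: the vector `v ∈ p` with `Q v = x` must be `P (x + z)`. -/
theorem rel_adjoint_comp_phi (h : IsGenericPair Γ p q) {x z : q} :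
    Rel (pcomp (phi h).adjoint (phi h)) x z ↔
      ∃ u ∈ q, q.starProjection (p.starProjection u) = x ∧
        u - q.starProjection (p.starProjection u) = z := by
  rw [rel_pcomp]
  constructor
  · rintro ⟨y, hxy, hyz⟩
    rw [rel_adjoint_phi] at hyz
    obtain ⟨v, hv, h1, h2⟩ := (rel_phi h).1 hxy
    have h3 : p.starProjection ((x : H) + z) = v := by
      refine (Submodule.eq_starProjection_of_mem_orthogonal hv ?_).symm ▸ rfl
      rw [← neg_mem_iff]
      convert hyz using 1
      rw [← h2, h1]
      abel
    refine ⟨x + z, add_mem x.2 z.2, ?_, ?_⟩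
    · rw [h3, h1]
    · rw [h3, h1, add_sub_cancel_left]
  · rintro ⟨u, hu, h1, h2⟩
    refine ⟨qᗮ.orthogonalProjectionOnto (p.starProjection u),
      (rel_phi h).2 ⟨_, p.starProjection_apply_mem u, h1,
        (q.starProjection_orthogonal_val _).symm⟩, (rel_adjoint_phi h).2 ?_⟩
    change qᗮ.starProjection (p.starProjection u) - _ ∈ _
    rw [q.starProjection_orthogonal_val, ← h2, ← neg_mem_iff]
    convert p.sub_starProjection_mem_orthogonal u using 1
    abel

/-! ### `Δ_p`, `φ*φ` and their roots in terms of `c` and `d`. -/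

namespace IsRotation

variable {c d W : H →L[ℂ] H}

theorem cosSin_left (hr : IsRotation Γ p q c d W) : CosSin (compress p c) (compress p d) :=
  hr.cosSin.compress hr.cos_left hr.sin_left

theorem cosSin_right (hr : IsRotation Γ p q c d W) : CosSin (compress q c) (compress q d) :=
  hr.cosSin.compress hr.cos_right hr.sin_right

theorem rel_modularOp_iff (hr : IsRotation Γ p q c d W) (h : IsGenericPair Γ p q) (x y : p) :
    Rel (modularOp h) x y ↔
      ∃ u, compress p c (compress p c u) = x ∧ compress p d (compress p d u) = y := by
  rw [rel_modularOp]
  have h1 : ∀ u : p, ((compress p c (compress p c u) : p) : H) =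
      p.starProjection (q.starProjection u) := fun u => by
    rw [coe_compress hr.cos_left, coe_compress hr.cos_left, hr.cos_cos_left _ u.2]
  have h2 : ∀ u : p, ((compress p d (compress p d u) : p) : H) =
      u - p.starProjection (q.starProjection u) := fun u => by
    rw [coe_compress hr.sin_left, coe_compress hr.sin_left, ← hr.cos_cos_left _ u.2]
    exact eq_sub_of_add_eq' (hr.cosSin.sq_add_sq _)
  constructor
  · rintro ⟨u, hu, hx, hy⟩
    exact ⟨⟨u, hu⟩, Subtype.ext ((h1 _).trans hx), Subtype.ext ((h2 _).trans hy)⟩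
  · rintro ⟨u, rfl, rfl⟩
    exact ⟨u, u.2, (h1 u).symm, (h2 u).symm⟩

theorem rel_adjoint_comp_phi_iff (hr : IsRotation Γ p q c d W) (h : IsGenericPair Γ p q)
    (x y : q) : Rel (pcomp (phi h).adjoint (phi h)) x y ↔
      ∃ u, compress q c (compress q c u) = x ∧ compress q d (compress q d u) = y := by
  rw [rel_adjoint_comp_phi]
  have h1 : ∀ u : q, ((compress q c (compress q c u) : q) : H) =
      q.starProjection (p.starProjection u) := fun u => by
    rw [coe_compress hr.cos_right, coe_compress hr.cos_right, hr.cos_cos_right _ u.2]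
  have h2 : ∀ u : q, ((compress q d (compress q d u) : q) : H) =
      u - q.starProjection (p.starProjection u) := fun u => by
    rw [coe_compress hr.sin_right, coe_compress hr.sin_right, ← hr.cos_cos_right _ u.2]
    exact eq_sub_of_add_eq' (hr.cosSin.sq_add_sq _)
  constructor
  · rintro ⟨u, hu, hx, hy⟩
    exact ⟨⟨u, hu⟩, Subtype.ext ((h1 _).trans hx), Subtype.ext ((h2 _).trans hy)⟩
  · rintro ⟨u, rfl, rfl⟩
    exact ⟨u, u.2, (h1 u).symm, (h2 u).symm⟩

theorem isPosSqrt_modularSqrt (hr : IsRotation Γ p q c d W) (h : IsGenericPair Γ p q) :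
    IsPosSqrt (modularOp h) (modularSqrt h) :=
  hr.cosSin_left.isPosSqrt_posSqrt (hr.rel_modularOp_iff h)

theorem isPosSqrt_absOp [CompleteSpace H] (hr : IsRotation Γ p q c d W)
    (h : IsGenericPair Γ p q) : IsPosSqrt (pcomp (phi h).adjoint (phi h)) (absOp (phi h)) :=
  hr.cosSin_right.isPosSqrt_posSqrt (hr.rel_adjoint_comp_phi_iff h)

theorem rel_modularSqrt (hr : IsRotation Γ p q c d W) (h : IsGenericPair Γ p q) {x y : p} :
    Rel (modularSqrt h) x y ↔ ∃ v ∈ p, c v = x ∧ d v = y := by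
  rw [modularSqrt, hr.cosSin_left.rel_posSqrt (hr.rel_modularOp_iff h)]
  constructor
  · rintro ⟨v, rfl, rfl⟩
    exact ⟨v, v.2, (coe_compress hr.cos_left v).symm, (coe_compress hr.sin_left v).symm⟩
  · rintro ⟨v, hv, hx, hy⟩
    exact ⟨⟨v, hv⟩, Subtype.ext ((coe_compress hr.cos_left _).trans hx),
      Subtype.ext ((coe_compress hr.sin_left _).trans hy)⟩

theorem rel_absOp [CompleteSpace H] (hr : IsRotation Γ p q c d W) (h : IsGenericPair Γ p q)
    {x y : q} : Rel (absOp (phi h)) x y ↔ ∃ v ∈ q, c v = x ∧ d v = y := by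
  rw [absOp, hr.cosSin_right.rel_posSqrt (hr.rel_adjoint_comp_phi_iff h)]
  constructor
  · rintro ⟨v, rfl, rfl⟩
    exact ⟨v, v.2, (coe_compress hr.cos_right v).symm, (coe_compress hr.sin_right v).symm⟩
  · rintro ⟨v, hv, hx, hy⟩
    exact ⟨⟨v, hv⟩, Subtype.ext ((coe_compress hr.cos_right _).trans hx),
      Subtype.ext ((coe_compress hr.sin_right _).trans hy)⟩

theorem ker_modularSqrt (hr : IsRotation Γ p q c d W) (h : IsGenericPair Γ p q) :
    LinearMap.ker (modularSqrt h).toFun = ⊥ := by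
  rw [Submodule.eq_bot_iff]
  intro x hx
  obtain ⟨v, -, h1, h2⟩ := (hr.rel_modularSqrt h).1 ⟨x.2, hx⟩
  have h3 : v = 0 := hr.sin_inj v h2
  refine Subtype.ext (Subtype.ext ?_)
  rw [← h1, h3, map_zero]
  rfl

end IsRotation

end Main

/-! ### The polar decomposition of `φ` -/

theorem rel_compPMap {E F G : Type*} [AddCommGroup E] [Module ℂ E] [AddCommGroup F] [Module ℂ F]
    [AddCommGroup G] [Module ℂ G] {U : F →ₗ[ℂ] G} {A : E →ₗ.[ℂ] F} {x : E} {y : G} :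
    Rel (U.compPMap A) x y ↔ ∃ z, Rel A x z ∧ U z = y := by
  constructor
  · rintro ⟨hx, rfl⟩
    exact ⟨A ⟨x, hx⟩, ⟨hx, rfl⟩, rfl⟩
  · rintro ⟨_, ⟨hx, rfl⟩, rfl⟩
    exact ⟨hx, rfl⟩

section Polar

variable {E F : Type*} [NormedAddCommGroup E] [InnerProductSpace ℂ E] [CompleteSpace E]
  [NormedAddCommGroup F] [InnerProductSpace ℂ F] [CompleteSpace F]

/-- `T` determines the partial isometry on the range of `A`. This identifies the chosen `sgnOp` with
an explicit operator. -/
theorem IsPolarDecomposition.unique {T : E →ₗ.[ℂ] F} {A : E →ₗ.[ℂ] E} {U V : E →L[ℂ] F}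
    (hU : IsPolarDecomposition T U A) (hV : IsPolarDecomposition T V A)
    (hA : Dense {y | ∃ x, Rel A x y}) : U = V := by
  refine ContinuousLinearMap.ext fun y => ?_
  refine hA.induction (P := fun y => U y = V y) ?_ (isClosed_eq (by fun_prop) (by fun_prop)) y
  rintro y ⟨x, hxy⟩
  have h1 : Rel T x (U y) := by
    rw [hU.eq_comp, rel_compPMap]
    exact ⟨y, hxy, rfl⟩
  have h2 : Rel T x (V y) := by
    rw [hV.eq_comp, rel_compPMap]
    exact ⟨y, hxy, rfl⟩
  exact h1.unique h2

theorem IsPolarDecomposition.sgnOp {T : E →ₗ.[ℂ] F} {U : E →L[ℂ] F}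
    (hU : IsPolarDecomposition T U (absOp T)) : IsPolarDecomposition T (sgnOp T) (absOp T) := by
  have : ∃ U, IsPolarDecomposition T U (absOp T) := ⟨U, hU⟩
  rw [PolarCAR.sgnOp, dif_pos this]
  exact this.choose_spec

end Polar

/-! ### The explicit sign operator and the two formulas. -/

section Sign

variable {H : Type*} [NormedAddCommGroup H] [InnerProductSpace ℂ H]
  {Γ : H ≃ₗᵢ⋆[ℂ] H} {p q : Submodule ℂ H} [CompleteSpace p] [CompleteSpace q]
  {c d W : H →L[ℂ] H}

namespace IsRotation

theorem proj_map (hr : IsRotation Γ p q c d W) {v : H} (hv : v ∈ q) :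
    q.starProjection (W v) = c v := by
  rw [← sub_eq_zero]
  refine hr.cosSin.cos_inj _ ?_
  rw [map_sub, ← hr.cos_right, hr.cos_map v hv, hr.cos_cos_right v hv, sub_self]

/-- The operator `d W - Γ d W Γ`, which restricts to `sgn φ` on `q`. -/
def signOp (Γ : H ≃ₗᵢ⋆[ℂ] H) (d W : H →L[ℂ] H) : H →L[ℂ] H :=
  d * W - conjOp Γ (d * W)

theorem signOp_apply (x : H) : signOp Γ d W x = d (W x) - Γ (d (W (Γ x))) := rfl

/-- The two terms are `W v - c P v` and `c (v - P v)`; `c P v` cancels in the difference, leaving `W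
v - c v = φ(c v)`. -/
theorem signOp_sin (hr : IsRotation Γ p q c d W) (h : IsGenericPair Γ p q) {v : H} (hv : v ∈ q) :
    signOp Γ d W (d v) = W v - q.starProjection (W v) := by
  have h2 : Γ (d (W (Γ (d v)))) = c (v - p.starProjection v) := by
    rw [hr.conj_sin, hr.conj_sin, hr.cos_comm, hr.cos_map _ (h.invariant v hv), h.conj_proj_conj]
  have h3 : d (W (d v)) = W v - c (p.starProjection v) := by
    rw [hr.sin_comm, ← hr.cos_map v hv]
    exact eq_sub_of_add_eq' (hr.cosSin.sq_add_sq _)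
  rw [signOp_apply, h2, h3, hr.proj_map hv, map_sub]
  abel

/-- Pythagoras twice: `‖v‖² = ‖W v‖²` splits off `‖c v‖²` both along `q` and through `c² + d² = 1`.
-/
theorem norm_sub_proj_map (hr : IsRotation Γ p q c d W) {v : H} (hv : v ∈ q) :
    ‖W v - q.starProjection (W v)‖ = ‖d v‖ := by
  have h1 := Submodule.norm_sq_eq_add_norm_sq_starProjection (W v) q
  rw [q.starProjection_orthogonal_val, hr.proj_map hv, hr.norm_map] at h1
  have h2 : ‖v‖ ^ 2 = ‖c v‖ ^ 2 + ‖d v‖ ^ 2 := by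
    have h3 : ⟪v, v⟫_ℂ = ⟪c v, c v⟫_ℂ + ⟪d v, d v⟫_ℂ := by
      rw [inner_left_of_nonneg hr.cosSin.cos_pos, inner_left_of_nonneg hr.cosSin.sin_pos,
        ← inner_add_right, hr.cosSin.sq_add_sq]
    simp only [inner_self_eq_norm_sq_to_K] at h3
    exact_mod_cast h3
  rw [hr.proj_map hv]
  exact (pow_left_inj₀ (norm_nonneg _) (norm_nonneg _) two_ne_zero).1 (by linarith)

theorem denseRange_sin [CompleteSpace H] (hr : IsRotation Γ p q c d W) : DenseRange d :=
  denseRange_of_nonneg hr.cosSin.sin_pos hr.sin_inj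

theorem signOp_proj_sin (hr : IsRotation Γ p q c d W) (h : IsGenericPair Γ p q) (y : H) :
    signOp Γ d W (q.starProjection (d y)) =
      W (q.starProjection y) - q.starProjection (W (q.starProjection y)) := by
  rw [hr.sin_right, hr.signOp_sin h (q.starProjection_apply_mem y)]

variable [CompleteSpace H]

theorem signOp_mem (hr : IsRotation Γ p q c d W) (h : IsGenericPair Γ p q) {x : H} (hx : x ∈ q) :
    signOp Γ d W x ∈ qᗮ := by
  rw [← Submodule.starProjection_eq_self_iff.2 hx]
  refine hr.denseRange_sin.induction_on (p := fun x => signOp Γ d W (q.starProjection x) ∈ qᗮ) x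
    (q.isClosed_orthogonal.preimage (by fun_prop)) fun y => ?_
  rw [hr.signOp_proj_sin h]
  exact q.sub_starProjection_mem_orthogonal _

theorem norm_signOp (hr : IsRotation Γ p q c d W) (h : IsGenericPair Γ p q) {x : H} (hx : x ∈ q) :
    ‖signOp Γ d W x‖ = ‖x‖ := by
  rw [← Submodule.starProjection_eq_self_iff.2 hx]
  refine hr.denseRange_sin.induction_on
    (p := fun x => ‖signOp Γ d W (q.starProjection x)‖ = ‖q.starProjection x‖) x
    (isClosed_eq (by fun_prop) (by fun_prop)) fun y => ?_
  rw [hr.signOp_proj_sin h, hr.norm_sub_proj_map (q.starProjection_apply_mem y), hr.sin_right]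

/-- The partial isometry `sgn φ`. -/
def sign (hr : IsRotation Γ p q c d W) (h : IsGenericPair Γ p q) : q →L[ℂ] qᗮ :=
  (signOp Γ d W ∘L q.subtypeL).codRestrict qᗮ fun x => hr.signOp_mem h x.2

theorem coe_sign (hr : IsRotation Γ p q c d W) (h : IsGenericPair Γ p q) (x : q) :
    (hr.sign h x : H) = signOp Γ d W x := rfl

theorem norm_sign (hr : IsRotation Γ p q c d W) (h : IsGenericPair Γ p q) (x : q) :
    ‖hr.sign h x‖ = ‖x‖ :=
  hr.norm_signOp h x.2

theorem isPolarDecomposition_sign (hr : IsRotation Γ p q c d W) (h : IsGenericPair Γ p q) :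
    IsPolarDecomposition (phi h) (hr.sign h) (absOp (phi h)) where
  abs := hr.isPosSqrt_absOp h
  partialIsometry x _ := hr.norm_sign h x
  ker_eq := by
    have h1 : LinearMap.ker (hr.sign h).toLinearMap = ⊥ := by
      rw [Submodule.eq_bot_iff]
      intro x hx
      rw [← norm_eq_zero, ← hr.norm_sign h, norm_eq_zero]
      exact hx
    have h2 : LinearMap.ker (phi h).toFun = ⊥ := by
      rw [Submodule.eq_bot_iff]
      intro x hx
      obtain ⟨v, hv, h3, h4⟩ := (rel_phi h).1 ⟨x.2, hx⟩
      refine Subtype.ext (Subtype.ext ?_)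
      have h5 : q.starProjection v = v := (sub_eq_zero.1 h4).symm
      have h6 := h.eq_zero_of_mem hv (Submodule.starProjection_eq_self_iff.1 h5)
      rw [← h3, h6, map_zero]
      rfl
    rw [h1, h2, Submodule.map_bot]
  eq_comp := by
    refine ext_rel fun x y => ?_
    rw [rel_compPMap, rel_phi]
    constructor
    · rintro ⟨w, hw, h1, h2⟩
      -- Because `W` maps `q` onto `p`, the graph of `φ` consists of the pairs `(c v, W v - c v)`
      -- with `v ∈ q`.
      obtain ⟨v, hv, rfl⟩ := hr.exists_eq w hw
      have h3 : d v ∈ q := by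
        rw [← Submodule.starProjection_eq_self_iff.2 hv, ← hr.sin_right]
        exact q.starProjection_apply_mem _
      refine ⟨⟨d v, h3⟩, (hr.rel_absOp h).2 ⟨v, hv, ?_, rfl⟩, Subtype.ext ?_⟩
      · rw [← h1, hr.proj_map hv]
      · exact (hr.signOp_sin h hv).trans h2
    · rintro ⟨z, hz, rfl⟩
      obtain ⟨v, hv, h1, h2⟩ := (hr.rel_absOp h).1 hz
      refine ⟨W v, hr.map_mem v hv, ?_, ?_⟩
      · rw [← h1, hr.proj_map hv]
      · rw [← hr.signOp_sin h hv, h2]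
        rfl

theorem sgnOp_phi (hr : IsRotation Γ p q c d W) (h : IsGenericPair Γ p q) :
    sgnOp (phi h) = hr.sign h := by
  have hU := hr.isPolarDecomposition_sign h
  refine hU.sgnOp.unique hU ?_
  have hd : DenseRange (compress q d) := denseRange_of_nonneg hr.cosSin_right.sin_pos
    fun x hx => Subtype.ext (hr.sin_inj _ (by rw [← coe_compress hr.sin_right, hx]; rfl))
  refine Dense.mono ?_ hd
  rintro _ ⟨v, rfl⟩
  exact ⟨compress q c v, (hr.rel_absOp h).2
    ⟨v, v.2, (coe_compress hr.cos_right v).symm, (coe_compress hr.sin_right v).symm⟩⟩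

/-- The range is closed, and it contains the projection of `p` to `qᗮ`, which is dense because `pᗮ`
meets `qᗮ` trivially. -/
theorem surjective_sign (hr : IsRotation Γ p q c d W) (h : IsGenericPair Γ p q) :
    Function.Surjective (hr.sign h) := by
  have hiso : Isometry (hr.sign h) :=
    AddMonoidHomClass.isometry_of_norm (hr.sign h) (hr.norm_sign h)
  have hdense : Dense (Set.range (hr.sign h)) := by
    refine Dense.mono ?_ (dense_range_projRestrict (r := p) (s := qᗮ) fun x hx hx' =>
      h.eq_zero_of_mem_orthogonal hx' hx)
    rintro _ ⟨w, rfl⟩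
    obtain ⟨v, hv, hw⟩ := hr.exists_eq w w.2
    have h3 : d v ∈ q := by
      rw [← Submodule.starProjection_eq_self_iff.2 hv, ← hr.sin_right]
      exact q.starProjection_apply_mem _
    refine ⟨⟨d v, h3⟩, Subtype.ext ?_⟩
    rw [coe_sign, hr.signOp_sin h hv, hw]
    exact (q.starProjection_orthogonal_val _).symm
  exact Set.range_eq_univ.1
    (hiso.isClosedEmbedding.isClosed_range.closure_eq ▸ hdense.closure_eq)

/-- Write `x = c²u`. Then `|φ| x = d c u` and `Δ_p^{1/2} P x = d c P u`, while `P Γ x = d² P Γ u`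
yields `Δ_p^{-1/2} P Γ x = c d P Γ u`. Applying `Γ` turns the last into `d c (1 - P) u`. -/
theorem absOp_formula (hr : IsRotation Γ p q c d W) (h : IsGenericPair Γ p q) (x : q)
    (hx : x ∈ (pcomp (phi h).adjoint (phi h)).domain) :
    ∃ y a b, Rel (absOp (phi h)) x y ∧ Rel (modularSqrt h) (p.orthogonalProjectionOnto (x : H)) a ∧
      Rel (modularInvSqrt h) (p.orthogonalProjectionOnto (Γ (x : H))) b ∧
      (y : H) = a + Γ b := by
  obtain ⟨z, hz⟩ := mem_domain_iff_rel.1 hx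
  obtain ⟨u, hu, h1, -⟩ := (rel_adjoint_comp_phi h).1 hz
  rw [← hr.cos_cos_right u hu] at h1
  have hcd : ∀ {s : Submodule ℂ H} [CompleteSpace s] {T : H →L[ℂ] H}
      (hT : ∀ x, s.starProjection (T x) = T (s.starProjection x)) {v : H}, v ∈ s → T v ∈ s := by
    intro s _ T hT v hv
    rw [← Submodule.starProjection_eq_self_iff.2 hv, ← hT]
    exact s.starProjection_apply_mem _
  have hp : ∀ v, p.starProjection v ∈ p := p.starProjection_apply_mem
  refine ⟨⟨d (c u), hcd hr.sin_right (hcd hr.cos_right hu)⟩,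
    ⟨d (c (p.starProjection u)), hcd hr.sin_left (hcd hr.cos_left (hp _))⟩,
    ⟨c (d (p.starProjection (Γ u))), hcd hr.cos_left (hcd hr.sin_left (hp _))⟩,
    (hr.rel_absOp h).2 ⟨c u, hcd hr.cos_right hu, h1, rfl⟩,
    (hr.rel_modularSqrt h).2 ⟨c (p.starProjection u), hcd hr.cos_left (hp _), ?_, rfl⟩,
    rel_inverse (hr.ker_modularSqrt h) ((hr.rel_modularSqrt h).2
      ⟨d (p.starProjection (Γ u)), hcd hr.sin_left (hp _), rfl, ?_⟩), ?_⟩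
  · change _ = p.starProjection x
    rw [← h1, hr.cos_left, hr.cos_left]
  · change _ = p.starProjection (Γ x)
    rw [← h1, hr.conj_cos, hr.conj_cos, hr.sin_left, hr.sin_left]
  · change d (c u) = d (c (p.starProjection u)) + Γ (c (d (p.starProjection (Γ u))))
    rw [hr.conj_cos, hr.conj_sin, h.conj_proj_conj, ← map_add, ← map_add, add_sub_cancel]

/-- `P v = c W v` with `W v ∈ p` puts `P v` in the domain of `Δ_p^{1/2}` for every `v ∈ q`. -/
theorem sign_formula (hr : IsRotation Γ p q c d W) (h : IsGenericPair Γ p q) (x : q) :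
    ∃ a b, Rel (modularSqrt h) (p.orthogonalProjectionOnto (x : H)) a ∧
      Rel (modularSqrt h) (p.orthogonalProjectionOnto (Γ (x : H))) b ∧
      (hr.sign h x : H) = a - Γ b := by
  have key : ∀ v ∈ q, ∃ a : p, (a : H) = d (W v) ∧
      Rel (modularSqrt h) (p.orthogonalProjectionOnto v) a := fun v hv => by
    have h1 : d (W v) ∈ p := by
      rw [← Submodule.starProjection_eq_self_iff.2 (hr.map_mem v hv), ← hr.sin_left]
      exact p.starProjection_apply_mem _
    exact ⟨⟨d (W v), h1⟩, rfl,
      (hr.rel_modularSqrt h).2 ⟨W v, hr.map_mem v hv, hr.cos_map v hv, rfl⟩⟩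
  obtain ⟨a, ha, ha'⟩ := key x x.2
  obtain ⟨b, hb, hb'⟩ := key (Γ x) (h.invariant x x.2)
  exact ⟨a, b, ha', hb', by rw [ha, hb]; rfl⟩

end IsRotation

theorem inner_map_map_of_norm_map {E F : Type*} [NormedAddCommGroup E] [InnerProductSpace ℂ E]
    [NormedAddCommGroup F] [InnerProductSpace ℂ F] {T : E →L[ℂ] F} (hT : ∀ x, ‖T x‖ = ‖x‖)
    (x y : E) : ⟪T x, T y⟫_ℂ = ⟪x, y⟫_ℂ :=
  LinearIsometry.inner_map_map (⟨T.toLinearMap, hT⟩ : E →ₗᵢ[ℂ] F) x y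

omit [CompleteSpace p] in
theorem adjoint_extendByZero_comp_self [CompleteSpace H] {T : q →L[ℂ] qᗮ}
    (hT : ∀ x, ‖T x‖ = ‖x‖) :
    ContinuousLinearMap.adjoint (extendByZero q T) ∘L extendByZero q T = q.starProjection := by
  refine ContinuousLinearMap.ext fun x => ext_inner_right ℂ fun y => ?_
  rw [ContinuousLinearMap.comp_apply, ContinuousLinearMap.adjoint_inner_left]
  change ⟪T (q.orthogonalProjectionOnto x), T (q.orthogonalProjectionOnto y)⟫_ℂ = _
  rw [inner_map_map_of_norm_map hT]
  exact Submodule.inner_orthogonalProjectionOnto_eq_of_mem_left (q.orthogonalProjectionOnto x) y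

-- Write the `qᗮ`-component of `y` as `V x` with `x ∈ q`. As `V*` kills `q`, `V* y = V* V x = x`.
omit [CompleteSpace p] in
theorem extendByZero_comp_adjoint [CompleteSpace H] {T : q →L[ℂ] qᗮ}
    (hT : ∀ x, ‖T x‖ = ‖x‖) (hs : Function.Surjective T) :
    extendByZero q T ∘L ContinuousLinearMap.adjoint (extendByZero q T) = qᗮ.starProjection := by
  set V := extendByZero q T
  have h1 : ∀ x, ContinuousLinearMap.adjoint V (V x) = q.starProjection x := fun x =>
    congrArg (fun A : H →L[ℂ] H => A x) (adjoint_extendByZero_comp_self hT)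
  have h2 : ∀ x : q, V x = T x := fun x => by
    change ((T (q.orthogonalProjectionOnto (x : H)) : qᗮ) : H) = T x
    rw [Submodule.orthogonalProjectionOnto_mem_subspace_eq_self]
  refine ContinuousLinearMap.ext fun y => ?_
  obtain ⟨x, hx⟩ := hs (qᗮ.orthogonalProjectionOnto y)
  have h3 : qᗮ.starProjection y = V x := by
    rw [h2, hx]
    rfl
  have h4 : ContinuousLinearMap.adjoint V (q.starProjection y) = 0 := by
    refine ext_inner_right ℂ fun z => ?_
    rw [ContinuousLinearMap.adjoint_inner_left, inner_zero_left]
    exact Submodule.inner_right_of_mem_orthogonal (q.starProjection_apply_mem y)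
      (T (q.orthogonalProjectionOnto z)).2
  have h5 : ContinuousLinearMap.adjoint V y = x := by
    rw [← Submodule.starProjection_add_starProjection_orthogonal (K := q) y, map_add, h4, zero_add,
      h3, h1, Submodule.starProjection_eq_self_iff.2 x.2]
  rw [h3, ContinuousLinearMap.comp_apply, h5]

end Sign

end PolarCAR

end

theorem mainTheorem5 {H : Type*} [NormedAddCommGroup H] [InnerProductSpace ℂ H] [CompleteSpace H]
    (Γ : H ≃ₗᵢ⋆[ℂ] H) (p q : Submodule ℂ H) [CompleteSpace p] [CompleteSpace q]
    (h : PolarCAR.IsGenericPair Γ p q) :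
    -- the operators occurring in the statement exist
    PolarCAR.IsPosSqrt (PolarCAR.modularOp h) (PolarCAR.modularSqrt h) ∧
    LinearMap.ker (PolarCAR.modularSqrt h).toFun = ⊥ ∧
    PolarCAR.IsPolarDecomposition (PolarCAR.phi h) (PolarCAR.sgnOp (PolarCAR.phi h))
      (PolarCAR.absOp (PolarCAR.phi h)) ∧
    -- the domain of `φ* φ` is `Q P q`
    ((PolarCAR.pcomp (PolarCAR.phi h).adjoint (PolarCAR.phi h)).domain : Set q) =
      Set.range (fun y : q => q.orthogonalProjectionOnto (p.starProjection (y : H))) ∧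
    -- the formula for `|φ|` on the domain of `φ* φ`
    (∀ x : q, x ∈ (PolarCAR.pcomp (PolarCAR.phi h).adjoint (PolarCAR.phi h)).domain →
      ∃ (hx : x ∈ (PolarCAR.absOp (PolarCAR.phi h)).domain)
        (h₁ : p.orthogonalProjectionOnto (x : H) ∈ (PolarCAR.modularSqrt h).domain)
        (h₂ : p.orthogonalProjectionOnto (Γ (x : H)) ∈ (PolarCAR.modularInvSqrt h).domain),
        ((PolarCAR.absOp (PolarCAR.phi h) ⟨x, hx⟩ : q) : H) =
          ((PolarCAR.modularSqrt h ⟨_, h₁⟩ : p) : H) +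
            Γ ((PolarCAR.modularInvSqrt h ⟨_, h₂⟩ : p) : H)) ∧
    -- the formula for `sgn φ` on `q`
    (∀ x : q,
      ∃ (h₁ : p.orthogonalProjectionOnto (x : H) ∈ (PolarCAR.modularSqrt h).domain)
        (h₂ : p.orthogonalProjectionOnto (Γ (x : H)) ∈ (PolarCAR.modularSqrt h).domain),
        ((PolarCAR.sgnOp (PolarCAR.phi h) x : qᗮ) : H) =
          ((PolarCAR.modularSqrt h ⟨_, h₁⟩ : p) : H) -
            Γ ((PolarCAR.modularSqrt h ⟨_, h₂⟩ : p) : H)) ∧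
    -- `sgn φ` is an isometry of `q` onto `q^⊥`
    Isometry (PolarCAR.sgnOp (PolarCAR.phi h)) ∧
    Function.Surjective (PolarCAR.sgnOp (PolarCAR.phi h)) ∧
    ContinuousLinearMap.adjoint (PolarCAR.extendByZero q (PolarCAR.sgnOp (PolarCAR.phi h))) ∘L
      PolarCAR.extendByZero q (PolarCAR.sgnOp (PolarCAR.phi h)) = q.starProjection ∧
    PolarCAR.extendByZero q (PolarCAR.sgnOp (PolarCAR.phi h)) ∘L
      ContinuousLinearMap.adjoint (PolarCAR.extendByZero q (PolarCAR.sgnOp (PolarCAR.phi h))) =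
        qᗮ.starProjection := by
  obtain ⟨c, d, W, hr⟩ := h.exists_isRotation
  have hn := hr.norm_sign h
  rw [hr.sgnOp_phi h]
  refine ⟨hr.isPosSqrt_modularSqrt h, hr.ker_modularSqrt h, hr.isPolarDecomposition_sign h,
    Set.ext fun x => ?_, fun x hx => ?_, fun x => ?_, AddMonoidHomClass.isometry_of_norm _ hn,
    hr.surjective_sign h, PolarCAR.adjoint_extendByZero_comp_self hn,
    PolarCAR.extendByZero_comp_adjoint hn (hr.surjective_sign h)⟩
  · rw [SetLike.mem_coe, PolarCAR.mem_domain_iff_rel]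
    simp only [PolarCAR.rel_adjoint_comp_phi]
    constructor
    · rintro ⟨_, u, hu, h1, -⟩
      exact ⟨⟨u, hu⟩, Subtype.ext h1⟩
    · rintro ⟨u, rfl⟩
      exact ⟨u - q.orthogonalProjectionOnto (p.starProjection (u : H)), u, u.2, rfl, rfl⟩
  · obtain ⟨_, _, _, ⟨h0, rfl⟩, ⟨h1, rfl⟩, ⟨h2, rfl⟩, e⟩ := hr.absOp_formula h x hx
    exact ⟨h0, h1, h2, e⟩
  · obtain ⟨_, _, ⟨h1, rfl⟩, ⟨h2, rfl⟩, e⟩ := hr.sign_formula h x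
    exact ⟨h1, h2, e⟩
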